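/- Fix $p\in(0,1]$. For $n\ge 1$ let $G$ be the random linear graph on the vertices $1,\dots,n$: each pair $i\neq j$ with $|i-j|\le n/2$ is joined by an edge with probability $p$, independently of all other pairs, and there are no other edges. Let $\widehat M$ be the adjacency matrix of $G$, and let a second eigenvector of $\widehat M$ be any eigenvector for the second eigenvalue $\lambda_2(\widehat M)$ in the decreasing list of its eigenvalues counted with multiplicity (the statement holds both for the order by value and for the order by absolute value). For $y\in\mathbb R^n$ let $\sigma_y$ denote a permutation with $y_{\sigma_y(1)}\ge y_{\sigma_y(2)}\ge\dots\ge y_{\sigma_y(n)}$ (ties broken arbitrarily), and for a permutation $\sigma$ let $D(\sigma)=|\{(i,j): i<j,\ \sigma(i)>\sigma(j)\}|$ be its Kendall distance. Theorem. There is a constant $C>0$, depending only on $p$, such that for every $n\ge1$, with probability at least $1-n^{-3}$, every second eigenvector $y$ of $\widehat M$, taken with the appropriate sign, satisfies $D(\sigma_y)\le C\,n^{9/5}$; that is, for every second eigenvector $y$ of $\widehat M$, the bound $D(\sigma)\le C\,n^{9/5}$ holds either for all permutations $\sigma=\sigma_{y}$ or for all permutations $\sigma=\sigma_{-y}$. 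-/

import Mathlib

open MeasureTheory ProbabilityTheory Matrix

/-- The model matrix (matrix of edge probabilities) of the random linear graph on `n` vertices:
`m i j = p` if `i ≠ j` and `|i - j| ≤ n / 2`, and `m i j = 0` otherwise. -/
noncomputable def modelMatrix (n : ℕ) (p : ℝ) : Matrix (Fin n) (Fin n) ℝ :=
  fun i j => if i ≠ j ∧ |(i : ℝ) - (j : ℝ)| ≤ (n : ℝ) / 2 then p else 0

/-- `G` is a random linear graph with link probability `p` on the probability space `(Ω, P)`: the
pairs `{i, j}` (listed with `i < j`) are edges independently of each other, with the
probabilities prescribed by the model matrix. -/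
structure IsRandomLinearGraph {Ω : Type*} [MeasurableSpace Ω] {n : ℕ} (p : ℝ)
    (G : Ω → SimpleGraph (Fin n)) (P : Measure Ω) : Prop where
  measurableSet_adj : ∀ i j, MeasurableSet {ω | (G ω).Adj i j}
  prob_adj : ∀ i j, i < j → P.real {ω | (G ω).Adj i j} = modelMatrix n p i j
  indep : iIndepSet
    (fun e : {e : Fin n × Fin n // e.1 < e.2} => {ω | (G ω).Adj e.1.1 e.1.2}) P

open Classical in
/-- The real adjacency matrix of a graph on `Fin n`. -/
noncomputable def adjacency {n : ℕ} (G : SimpleGraph (Fin n)) : Matrix (Fin n) (Fin n) ℝ :=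
  G.adjMatrix ℝ

theorem adjacency_isHermitian {n : ℕ} (G : SimpleGraph (Fin n)) : (adjacency G).IsHermitian := by
  classical
  unfold adjacency Matrix.IsHermitian
  rw [Matrix.conjTranspose_eq_transpose_of_trivial]
  exact G.isSymm_adjMatrix

/-- `μ` is a second entry of the finite family `v`, counted with multiplicity, when `v` is listed
in decreasing order of `key`: some entry `v j = μ` is maximal among all the entries other than one
top entry `v i`, which has a different index. -/
def IsSecondBy {n : ℕ} (key : ℝ → ℝ) (v : Fin n → ℝ) (μ : ℝ) : Prop :=
  ∃ i j, i ≠ j ∧ v j = μ ∧ key μ ≤ key (v i) ∧ ∀ k, k ≠ i → key (v k) ≤ key μ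

/-- `y` is a second eigenvector of the symmetric matrix `A`: an eigenvector for the second
eigenvalue of `A`, the eigenvalues being counted with multiplicity and listed in decreasing order,
either by value or by absolute value (both conventions are admitted). -/
def IsSecondEigenvector {n : ℕ} {A : Matrix (Fin n) (Fin n) ℝ} (hA : A.IsHermitian)
    (y : Fin n → ℝ) : Prop :=
  y ≠ 0 ∧ ∃ μ : ℝ, (IsSecondBy id hA.eigenvalues μ ∨ IsSecondBy abs hA.eigenvalues μ) ∧
    A *ᵥ y = μ • y

/-- `σ` is a permutation obtained by ordering the components of `y` decreasingly:
`y (σ 1) ≥ y (σ 2) ≥ … ≥ y (σ n)` (ties may be broken in any way). -/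
def IsSortingPerm {n : ℕ} (y : Fin n → ℝ) (σ : Equiv.Perm (Fin n)) : Prop :=
  ∀ i j, i ≤ j → y (σ j) ≤ y (σ i)

/-- The Kendall distance (number of inversions) of a permutation. -/
def kendallDist {n : ℕ} (σ : Equiv.Perm (Fin n)) : ℕ :=
  (Finset.univ.filter fun e : Fin n × Fin n => e.1 < e.2 ∧ σ e.2 < σ e.1).card

/-!
The model matrix `M` is a discretization of `p n` times the integral operator on `[0, 1]` with
kernel `1_{|x - y| ≤ 1/2}`, whose second eigenfunction is exactly `cos (π x)`, with eigenvalue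
`1/π`. Accordingly the sampled cosine `f = cosVec n` satisfies `M f = l f` up to a bounded error in
each coordinate (`abs_modelMatrix_mulVec_cosVec_sub_le`), with `l ≥ p n / π`. The constant
vector has Rayleigh quotient about `(3/4) p n`, and `‖M‖² ≈ (3/4) (p n)²` in the Frobenius norm.
As `3/4 - 9/16 - 1/π² < 0.295²`, removing the components of the constant vector and of `f` leaves
a matrix of norm at most `0.295 p n < l` (`modelMatrix_frobenius_le`). This is the spectral gap
on both sides of `l`, and it does not require the rest of the spectrum of `M`.

Let `E` be the adjacency matrix minus `M`. Two consequences of Hoeffding's inequality and the union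
bound suffice (`IsRandomLinearGraph.measureReal_noise_large_le`). Each coordinate of `E f` is
`O(√(n log n))`. Each entry of `E ^ 2` off the diagonal, a sum of products over disjoint pairs of
edges, is `O(√(n log n))` as well, so that `‖E‖⁴ ≤ ‖E ^ 2‖²` is of order `n³ log n` and
`‖E‖ = o(n)`. This crude bound on `‖E‖` preserves the spectral gap, while the error in
the eigenvector depends on `E f` only (`ApproxDecomp.norm_sub_le_of_isSecondBy`): with the right
sign and scaling, a second eigenvector is `f + η` with `∑ η i ^ 2 = O(log n)`. The order by absolute
value makes no difference, since the negative eigenvalues are too small.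

Finally `f a - f b ≥ 2 ((b - a) / n)²` for `a < b`, so a pair inverted by sorting `f + η` has
`b - a ≤ n √|η a|` or `b - a ≤ n √|η b|`. There are at most `2 n ∑ √|η i|` such pairs, which is
`O(n^{7/4} (log n)^{1/4})` by the Cauchy-Schwarz inequality (`kendallDist_pow_four_le`).
-/

/-! ### Second eigenvectors of approximately decomposed symmetric operators -/

section Spectral
variable {V : Type*} [NormedAddCommGroup V] [InnerProductSpace ℝ V]

open scoped RealInnerProductSpace

/-- The easy half of the min-max principle: off one eigenvector, the quadratic form is bounded by
the largest of the other eigenvalues. -/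
theorem inner_map_le_of_inner_eq_zero {n : ℕ} {T : V →ₗ[ℝ] V} (hT : T.IsSymmetric)
    (b : OrthonormalBasis (Fin n) ℝ V) {v : Fin n → ℝ} (hb : ∀ k, T (b k) = v k • b k)
    {i : Fin n} {c : ℝ} (hv : ∀ k, k ≠ i → v k ≤ c) {z : V} (hz : ⟪b i, z⟫ = 0) :
    ⟪z, T z⟫ ≤ c * ‖z‖ ^ 2 := by
  rw [← b.sum_inner_mul_inner, ← b.sum_sq_norm_inner_right z, Finset.mul_sum]
  refine Finset.sum_le_sum fun k _ => ?_
  rw [← hT (b k) z, hb, real_inner_smul_left, real_inner_comm (b k) z, Real.norm_eq_abs, sq_abs]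
  by_cases h : k = i
  · subst h; rw [hz]; simp
  · nlinarith [hv k h, sq_nonneg ⟪b k, z⟫]

/-- In the plane spanned by two vectors there is a nonzero vector orthogonal to a given one. -/
theorem exists_combination_inner_eq_zero (s t u : V) :
    ∃ b c : ℝ, (b ≠ 0 ∨ c ≠ 0) ∧ ⟪u, b • s + c • t⟫ = 0 := by
  by_cases h : ⟪u, s⟫ = 0
  · exact ⟨1, 0, by simp, by simp [h]⟩
  · refine ⟨⟪u, t⟫, -⟪u, s⟫, Or.inr (by simpa using h), ?_⟩
    rw [inner_add_right, real_inner_smul_right, real_inner_smul_right]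
    ring

theorem norm_sq_combination {s t : V} (hs : ‖s‖ = 1) (ht : ‖t‖ = 1) (hst : ⟪s, t⟫ = 0) (b c : ℝ) :
    ‖b • s + c • t‖ ^ 2 = b ^ 2 + c ^ 2 := by
  rw [norm_add_sq_real, norm_smul, norm_smul, real_inner_smul_left, real_inner_smul_right, hst, hs,
    ht]
  simp

theorem inner_map_combination {T : V →ₗ[ℝ] V} (hT : T.IsSymmetric) (s t : V) (b c : ℝ) :
    ⟪b • s + c • t, T (b • s + c • t)⟫ =
      b ^ 2 * ⟪s, T s⟫ + 2 * (b * c) * ⟪s, T t⟫ + c ^ 2 * ⟪t, T t⟫ := by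
  have h : ⟪t, T s⟫ = ⟪s, T t⟫ := by rw [← hT t s, real_inner_comm]
  simp only [map_add, map_smul, inner_add_left, inner_add_right, real_inner_smul_left,
    real_inner_smul_right, h]
  ring

/-- The data of an approximate spectral decomposition of a symmetric operator `T`:
up to an error `ρ` its quadratic form is that of `α e eᵀ + l x xᵀ` with `e`, `x` orthonormal, and
`x` is an eigenvector for `l` up to an error `κ`. The errors are so small compared with
the spectral gap that at least `g` of it is left. -/
structure ApproxDecomp (T : V →ₗ[ℝ] V) (e x : V) (α l ρ κ g : ℝ) : Prop where
  symm : T.IsSymmetric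
  norm_e : ‖e‖ = 1
  norm_x : ‖x‖ = 1
  inner_e_x : ⟪e, x⟫ = 0
  quad : ∀ z, |⟪z, T z⟫ - α * ⟪e, z⟫ ^ 2 - l * ⟪x, z⟫ ^ 2| ≤ ρ * ‖z‖ ^ 2
  approx : ‖T x - l • x‖ ≤ κ
  α_nonneg : 0 ≤ α
  l_nonneg : 0 ≤ l
  g_pos : 0 < g
  gap_below : ρ + g ≤ l - 3 * κ
  gap_above : l + 2 * κ + g ≤ ⟪e, T e⟫

namespace ApproxDecomp
variable {T : V →ₗ[ℝ] V} {e x : V} {α l ρ κ g : ℝ}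

theorem κ_nonneg (h : ApproxDecomp T e x α l ρ κ g) : 0 ≤ κ := (norm_nonneg _).trans h.approx

theorem abs_inner_sub_le (h : ApproxDecomp T e x α l ρ κ g) (z : V) :
    |⟪z, T x⟫ - l * ⟪z, x⟫| ≤ κ * ‖z‖ := by
  rw [← real_inner_smul_right, ← inner_sub_right]
  exact (abs_real_inner_le_norm _ _).trans (by nlinarith [h.approx, norm_nonneg z])

theorem inner_x_map_x (h : ApproxDecomp T e x α l ρ κ g) : |⟪x, T x⟫ - l| ≤ κ := by
  simpa [h.norm_x] using h.abs_inner_sub_le x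

/-- Negative eigenvalues are small. -/
theorem neg_le_of_eigen (h : ApproxDecomp T e x α l ρ κ g) {y : V} {μ : ℝ} (hy : y ≠ 0)
    (hTy : T y = μ • y) : -ρ ≤ μ := by
  have h1 := (abs_le.1 (h.quad y)).1
  rw [hTy, real_inner_smul_right, real_inner_self_eq_norm_sq] at h1
  have := mul_nonneg h.α_nonneg (sq_nonneg ⟪e, y⟫)
  have := mul_nonneg h.l_nonneg (sq_nonneg ⟪x, y⟫)
  have : 0 < ‖y‖ ^ 2 := by positivity
  by_contra! hc
  nlinarith

/-- On the orthogonal complement of `e` the quadratic form is at most about `l`. -/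
theorem inner_map_le (h : ApproxDecomp T e x α l ρ κ g) {z : V} (hz : ⟪e, z⟫ = 0) :
    ⟪z, T z⟫ ≤ (l + 2 * κ) * ‖z‖ ^ 2 := by
  set a := ⟪x, z⟫ with ha
  set w := z - a • x with hw
  have hxw : ⟪x, w⟫ = 0 := by
    rw [hw, inner_sub_right, real_inner_smul_right, real_inner_self_eq_norm_sq, h.norm_x]; simp [ha]
  have hew : ⟪e, w⟫ = 0 := by
    rw [hw, inner_sub_right, real_inner_smul_right, h.inner_e_x, hz]; simp
  have hz' : z = a • x + (1 : ℝ) • w := by simp [hw]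
  have hn : ‖z‖ ^ 2 = a ^ 2 + ‖w‖ ^ 2 := by
    rw [hz', norm_add_sq_real, norm_smul, norm_smul, real_inner_smul_left, real_inner_smul_right,
      hxw, h.norm_x]
    simp
  have hq : ⟪z, T z⟫ = a ^ 2 * ⟪x, T x⟫ + 2 * a * ⟪w, T x⟫ + ⟪w, T w⟫ := by
    have e1 : ⟪x, T w⟫ = ⟪w, T x⟫ := by rw [← h.symm, real_inner_comm]
    rw [hz', inner_map_combination h.symm, e1]; ring
  have h1 := (abs_le.1 h.inner_x_map_x).2
  have h2 := h.abs_inner_sub_le w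
  rw [real_inner_comm x w, hxw, mul_zero, sub_zero] at h2
  have h3 := (abs_le.1 (h.quad w)).2
  rw [hxw, hew] at h3
  have h4 : 2 * a * ⟪w, T x⟫ ≤ κ * (a ^ 2 + ‖w‖ ^ 2) := by
    have e1 : a * ⟪w, T x⟫ ≤ |a| * (κ * ‖w‖) :=
      (le_abs_self _).trans (by rw [abs_mul]; exact mul_le_mul_of_nonneg_left h2 (abs_nonneg _))
    rw [← sq_abs a]
    nlinarith [mul_nonneg h.κ_nonneg (sq_nonneg (|a| - ‖w‖))]
  have h5 := h.gap_below
  have h6 := h.g_pos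
  have h7 := h.κ_nonneg
  rw [hq, hn]
  nlinarith [sq_nonneg a, sq_nonneg ‖w‖]

/-- The quadratic form is at least about `l` on the plane spanned by `e` and `x`, so by
the min-max principle this bounds the second eigenvalue from below. -/
theorem le_of_forall_ne (h : ApproxDecomp T e x α l ρ κ g) {n : ℕ}
    (b : OrthonormalBasis (Fin n) ℝ V) {v : Fin n → ℝ} (hb : ∀ k, T (b k) = v k • b k)
    {i : Fin n} {c : ℝ} (hv : ∀ k, k ≠ i → v k ≤ c) : l - 2 * κ ≤ c := by
  obtain ⟨s, t, hst, hz⟩ := exists_combination_inner_eq_zero e x (b i)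
  have h1 := inner_map_le_of_inner_eq_zero h.symm b hb hv hz
  rw [inner_map_combination h.symm, norm_sq_combination h.norm_e h.norm_x h.inner_e_x] at h1
  have h2 := h.abs_inner_sub_le e
  rw [h.inner_e_x, h.norm_e, mul_zero, sub_zero, mul_one] at h2
  have h3 := (abs_le.1 h.inner_x_map_x).1
  have h4 := h.gap_above
  have h5 := h.g_pos
  have h6 := h.κ_nonneg
  have hpos : 0 < s ^ 2 + t ^ 2 := by
    rcases hst with h | h
    · have := sq_nonneg t; have : 0 < s ^ 2 := by positivity
      linarith
    · have := sq_nonneg s; have : 0 < t ^ 2 := by positivity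
      linarith
  have h7 : -(κ * (s ^ 2 + t ^ 2)) ≤ 2 * (s * t) * ⟪e, T x⟫ := by
    have e1 : |s * t * ⟪e, T x⟫| ≤ |s| * |t| * κ := by
      rw [abs_mul, abs_mul]
      exact mul_le_mul_of_nonneg_left h2 (by positivity)
    rw [← sq_abs s, ← sq_abs t]
    nlinarith [(abs_le.1 e1).1, mul_nonneg h6 (sq_nonneg (|s| - |t|))]
  by_contra! hc
  nlinarith [sq_nonneg s, sq_nonneg t]

/-- A second eigenvalue, in either order, lies within `2 κ` of `l`. -/
theorem abs_sub_le_of_isSecondBy (h : ApproxDecomp T e x α l ρ κ g) {n : ℕ}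
    (b : OrthonormalBasis (Fin n) ℝ V) {v : Fin n → ℝ} (hb : ∀ k, T (b k) = v k • b k) {μ : ℝ}
    (hμ : IsSecondBy id v μ ∨ IsSecondBy abs v μ) : |μ - l| ≤ 2 * κ := by
  have hvk : ∀ k, -ρ ≤ v k := fun k =>
    h.neg_le_of_eigen (b.orthonormal.ne_zero k) (hb k)
  have h5 := h.gap_below
  have h6 := h.g_pos
  have h7 := h.κ_nonneg
  -- By absolute value the two leading eigenvalues exceed `ρ` in modulus, so they are positive and
  -- the two orders agree as far as they are concerned.
  have key : ∃ i j, i ≠ j ∧ v j = μ ∧ μ ≤ v i ∧ l - 2 * κ ≤ μ := by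
    rcases hμ with ⟨i, j, hij, hj, hi, hk⟩ | ⟨i, j, hij, hj, hi, hk⟩
    · exact ⟨i, j, hij, hj, hi, h.le_of_forall_ne b hb hk⟩
    · have h1 : l - 2 * κ ≤ |μ| :=
        h.le_of_forall_ne b hb fun k hki => (le_abs_self _).trans (hk k hki)
      have h2 := hvk i
      have h3 := hvk j
      rw [hj] at h3
      have hμ0 : 0 ≤ μ := by
        by_contra! hc
        rw [abs_of_neg hc] at h1
        linarith
      have hi0 : 0 ≤ v i := by
        by_contra! hc
        rw [abs_of_neg hc] at hi
        linarith
      rw [abs_of_nonneg hμ0, abs_of_nonneg hi0] at hi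
      rw [abs_of_nonneg hμ0] at h1
      exact ⟨i, j, hij, hj, hi, h1⟩
  obtain ⟨i, j, hij, hj, hi, hlow⟩ := key
  obtain ⟨s, t, hst, hz⟩ := exists_combination_inner_eq_zero (b i) (b j) e
  have h1 := h.inner_map_le hz
  have horth : ⟪b i, b j⟫ = 0 := b.orthonormal.2 hij
  rw [inner_map_combination h.symm,
    norm_sq_combination (b.orthonormal.1 i) (b.orthonormal.1 j) horth, hb i, hb j,
    real_inner_smul_right, real_inner_smul_right, real_inner_smul_right, horth,
    real_inner_self_eq_norm_sq, real_inner_self_eq_norm_sq, b.orthonormal.1 i, b.orthonormal.1 j,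
    hj] at h1
  have hpos : 0 < s ^ 2 + t ^ 2 := by
    rcases hst with h | h
    · have := sq_nonneg t; have : 0 < s ^ 2 := by positivity
      linarith
    · have := sq_nonneg s; have : 0 < t ^ 2 := by positivity
      linarith
  rw [abs_le]
  refine ⟨by linarith, ?_⟩
  by_contra! hc
  nlinarith [sq_nonneg s, sq_nonneg t]

/-- A second eigenvector is close to a multiple of `x`. The operator `T - μ` is bounded below
on the orthogonal complement of `x`, as testing it on a vector against its reflection in the line
of `e` shows. -/
theorem norm_sub_le_of_isSecondBy (h : ApproxDecomp T e x α l ρ κ g) {n : ℕ}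
    (b : OrthonormalBasis (Fin n) ℝ V) {v : Fin n → ℝ} (hb : ∀ k, T (b k) = v k • b k) {μ : ℝ}
    (hμ : IsSecondBy id v μ ∨ IsSecondBy abs v μ) {y : V} (hy : T y = μ • y) :
    g * ‖y - ⟪x, y⟫ • x‖ ≤ κ * |⟪x, y⟫| := by
  have hμ' := abs_le.1 (h.abs_sub_le_of_isSecondBy b hb hμ)
  set a := ⟪x, y⟫ with ha
  set w := y - a • x with hw
  have hxw : ⟪x, w⟫ = 0 := by
    rw [hw, inner_sub_right, real_inner_smul_right, real_inner_self_eq_norm_sq, h.norm_x]; simp [ha]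
  set c := ⟪e, w⟫ with hc
  set z := w - c • e with hz
  have hxe : ⟪x, e⟫ = 0 := by rw [real_inner_comm, h.inner_e_x]
  have hxz : ⟪x, z⟫ = 0 := by
    rw [hz, inner_sub_right, real_inner_smul_right, hxw, hxe]; simp
  have hez : ⟪e, z⟫ = 0 := by
    rw [hz, inner_sub_right, real_inner_smul_right, real_inner_self_eq_norm_sq, h.norm_e]; simp [hc]
  have hwz : w = c • e + z := by simp [hz]
  have hze : ⟪z, e⟫ = 0 := by rw [real_inner_comm, hez]
  have hwn : ‖w‖ ^ 2 = c ^ 2 + ‖z‖ ^ 2 := by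
    rw [hwz, norm_add_sq_real, norm_smul, real_inner_smul_left, hez, h.norm_e]
    simp
  have hwn' : ‖c • e - z‖ = ‖w‖ := by
    rw [← sq_eq_sq₀ (norm_nonneg _) (norm_nonneg _), hwn, norm_sub_sq_real, norm_smul,
      real_inner_smul_left, hez, h.norm_e]
    simp
  have hTw : T w - μ • w = -(a • (T x - l • x)) - (a * (l - μ)) • x := by
    rw [hw, map_sub, map_smul, hy]; module
  have h1 : ⟪c • e - z, T w - μ • w⟫ ≤ |a| * κ * ‖w‖ := by
    have : ⟪c • e - z, x⟫ = 0 := by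
      rw [inner_sub_left, real_inner_smul_left, h.inner_e_x, real_inner_comm, hxz]; simp
    rw [hTw, inner_sub_right, real_inner_smul_right _ x, this, inner_neg_right,
      real_inner_smul_right, mul_zero, sub_zero]
    refine (neg_le_abs _).trans ?_
    rw [abs_mul, mul_assoc, ← hwn']
    refine mul_le_mul_of_nonneg_left ?_ (abs_nonneg _)
    refine (abs_real_inner_le_norm _ _).trans ?_
    rw [mul_comm]
    exact mul_le_mul_of_nonneg_right h.approx (norm_nonneg _)
  have h2 : ⟪c • e - z, T w - μ • w⟫ = c ^ 2 * (⟪e, T e⟫ - μ) + (μ * ‖z‖ ^ 2 - ⟪z, T z⟫) := by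
    have e1 : ⟪z, T e⟫ = ⟪e, T z⟫ := by rw [← h.symm z e, real_inner_comm]
    rw [hwz]
    simp only [map_add, map_smul, inner_add_right, inner_sub_left, inner_sub_right, smul_add,
      real_inner_smul_left, real_inner_smul_right, e1, hez, hze, real_inner_self_eq_norm_sq,
      norm_smul, mul_pow, Real.norm_eq_abs, sq_abs, h.norm_e]
    ring
  have h3 := (abs_le.1 (h.quad z)).2
  rw [hxz, hez] at h3
  have h4 := h.gap_above
  have h5 := h.gap_below
  have h7 := h.κ_nonneg
  have h6 : g * ‖w‖ ^ 2 ≤ |a| * κ * ‖w‖ := by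
    rw [hwn]
    nlinarith [sq_nonneg c, sq_nonneg ‖z‖]
  rcases (norm_nonneg w).eq_or_lt with h0 | h0
  · rw [← h0]
    have := abs_nonneg a
    rw [mul_zero]; positivity
  · have : (g * ‖w‖) * ‖w‖ ≤ (κ * |a|) * ‖w‖ := by linarith [h6]
    exact le_of_mul_le_mul_right this h0

end ApproxDecomp
end Spectral

/-! ### Hoeffding bounds for linear and quadratic sums -/

section Concentration

open scoped NNReal

variable {Ω : Type*} [MeasurableSpace Ω] {P : Measure Ω} [IsProbabilityMeasure P]

theorem hasSubgaussianMGF_one {X : Ω → ℝ} (hm : Measurable X) (hb : ∀ ω, |X ω| ≤ 1)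
    (h0 : ∫ ω, X ω ∂P = 0) : HasSubgaussianMGF X 1 P := by
  have h := hasSubgaussianMGF_of_mem_Icc_of_integral_eq_zero (μ := P) (a := -1) (b := 1)
    hm.aemeasurable (Filter.Eventually.of_forall fun ω => abs_le.1 (hb ω)) h0
  have e : ((‖(1 : ℝ) - (-1)‖₊ / 2) ^ 2 : ℝ≥0) = 1 := by
    ext; push_cast; norm_num
  rwa [e] at h

theorem measureReal_le_abs_le {X : Ω → ℝ} {c : ℝ≥0} (h : HasSubgaussianMGF X c P) {ε : ℝ}
    (hε : 0 ≤ ε) : P.real {ω | ε ≤ |X ω|} ≤ 2 * Real.exp (-ε ^ 2 / (2 * c)) := by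
  have hs : {ω | ε ≤ |X ω|} ⊆ {ω | ε ≤ X ω} ∪ {ω | ε ≤ (-X) ω} := by
    intro ω hω
    simpa [le_abs] using hω
  calc P.real {ω | ε ≤ |X ω|} ≤ P.real ({ω | ε ≤ X ω} ∪ {ω | ε ≤ (-X) ω}) := measureReal_mono hs
    _ ≤ P.real {ω | ε ≤ X ω} + P.real {ω | ε ≤ (-X) ω} := measureReal_union_le _ _
    _ ≤ _ := by
      have h1 := h.measure_ge_le hε
      have h2 := h.neg.measure_ge_le hε
      linarith

variable {ι κ : Type*} {X : ι → Ω → ℝ}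

theorem hasSubgaussianMGF_weighted_sum (hX : iIndepFun X P) (hm : ∀ i, Measurable (X i))
    (hb : ∀ i ω, |X i ω| ≤ 1) (h0 : ∀ i, ∫ ω, X i ω ∂P = 0) {a : κ → ι}
    (ha : Function.Injective a) {f : κ → ℝ} (hf : ∀ k, |f k| ≤ 1) (s : Finset κ) :
    HasSubgaussianMGF (fun ω => ∑ k ∈ s, X (a k) ω * f k) s.card P := by
  have h1 : iIndepFun (fun k ω => X (a k) ω * f k) P :=
    (hX.precomp ha).comp (fun k x => x * f k) fun k => measurable_id.mul_const _
  have h2 := HasSubgaussianMGF.sum_of_iIndepFun h1 (c := fun _ => 1) (s := s) fun k _ => by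
    refine hasSubgaussianMGF_one ((hm _).mul_const _) (fun ω => ?_) ?_
    · rw [abs_mul]
      exact mul_le_one₀ (hb _ _) (abs_nonneg _) (hf _)
    · rw [integral_mul_const, h0, zero_mul]
  simpa using h2

/-- Products of pairwise disjoint pairs of independent centred variables behave like independent
centred variables. -/
theorem hasSubgaussianMGF_sum_mul (hX : iIndepFun X P) (hm : ∀ i, Measurable (X i))
    (hb : ∀ i ω, |X i ω| ≤ 1) (h0 : ∀ i, ∫ ω, X i ω ∂P = 0) {a b : κ → ι}
    (ha : Function.Injective a) (hb' : Function.Injective b) (hab : ∀ k l, a k ≠ b l)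
    (s : Finset κ) :
    HasSubgaussianMGF (fun ω => ∑ k ∈ s, X (a k) ω * X (b k) ω) s.card P := by
  classical
  induction s using Finset.induction_on with
  | empty => simp
  | insert k s hk ih =>
    have hterm : HasSubgaussianMGF (fun ω => X (a k) ω * X (b k) ω) 1 P := by
      refine hasSubgaussianMGF_one ((hm _).mul (hm _)) (fun ω => ?_) ?_
      · rw [abs_mul]
        exact mul_le_one₀ (hb _ _) (abs_nonneg _) (hb _ _)
      · have := (hX.indepFun (hab k k)).integral_mul_eq_mul_integral
          (hm _).aestronglyMeasurable (hm _).aestronglyMeasurable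
        simpa [h0] using this
    have hdisj : Disjoint ({a k, b k} : Finset ι) (s.image a ∪ s.image b) := by
      rw [Finset.disjoint_left]
      intro i hi hi'
      simp only [Finset.mem_insert, Finset.mem_singleton, Finset.mem_union, Finset.mem_image]
        at hi hi'
      rcases hi with rfl | rfl
      · rcases hi' with ⟨l, hl, h⟩ | ⟨l, hl, h⟩
        · exact hk (ha h ▸ hl)
        · exact hab _ _ h.symm
      · rcases hi' with ⟨l, hl, h⟩ | ⟨l, hl, h⟩
        · exact hab _ _ h
        · exact hk (hb' h ▸ hl)
    have hind := hX.indepFun_finset _ _ hdisj hm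
    have hψ : Measurable fun v : (s.image a ∪ s.image b : Finset ι) → ℝ => ∑ l ∈ s.attach,
        v ⟨a l, Finset.mem_union_left _ (Finset.mem_image_of_mem a l.2)⟩ *
        v ⟨b l, Finset.mem_union_right _ (Finset.mem_image_of_mem b l.2)⟩ :=
      Finset.measurable_fun_sum _ fun l _ => (measurable_pi_apply _).mul (measurable_pi_apply _)
    have hφ : Measurable fun v : ({a k, b k} : Finset ι) → ℝ =>
        v ⟨a k, by simp⟩ * v ⟨b k, by simp⟩ :=
      (measurable_pi_apply _).mul (measurable_pi_apply _)
    have hind2 : IndepFun (fun ω => X (a k) ω * X (b k) ω)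
        (fun ω => ∑ l ∈ s, X (a l) ω * X (b l) ω) P := by
      have h := hind.comp hφ hψ
      have e : (fun ω => ∑ l ∈ s, X (a l) ω * X (b l) ω) =
          fun ω => ∑ l ∈ s.attach, X (a l) ω * X (b l) ω :=
        funext fun ω => (Finset.sum_attach s fun l => X (a l) ω * X (b l) ω).symm
      rw [e]
      exact h
    have := hterm.add_of_indepFun ih hind2
    have e : (((insert k s).card : ℕ) : ℝ≥0) = 1 + s.card := by
      rw [Finset.card_insert_of_notMem hk]; push_cast; ring
    rw [e]
    refine this.congr (Filter.Eventually.of_forall fun ω => ?_)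
    simp [Finset.sum_insert hk]

end Concentration

/-! ### The noise matrix of a random linear graph -/

section Noise

variable {Ω : Type*} [MeasurableSpace Ω] {P : Measure Ω} {n : ℕ} {p : ℝ}
  {G : Ω → SimpleGraph (Fin n)}

/-- The deviation of the adjacency matrix of `G` from the model matrix. -/
noncomputable def noise (p : ℝ) {n : ℕ} (G : SimpleGraph (Fin n)) : Matrix (Fin n) (Fin n) ℝ :=
  adjacency G - modelMatrix n p

theorem modelMatrix_comm (n : ℕ) (p : ℝ) (i j : Fin n) :
    modelMatrix n p i j = modelMatrix n p j i := by
  simp only [modelMatrix, ne_comm (a := i), abs_sub_comm (i : ℝ)]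

theorem modelMatrix_mem_Icc (hp0 : 0 ≤ p) (hp1 : p ≤ 1) (i j : Fin n) :
    modelMatrix n p i j ∈ Set.Icc (0 : ℝ) 1 := by
  unfold modelMatrix
  split_ifs <;> simp [hp0, hp1]

theorem noise_comm (G : SimpleGraph (Fin n)) (i j : Fin n) : noise p G i j = noise p G j i := by
  have h : adjacency G i j = adjacency G j i := by
    simpa using (adjacency_isHermitian G).apply j i
  simp [noise, modelMatrix_comm n p i j, h]

theorem noise_self (G : SimpleGraph (Fin n)) (i : Fin n) : noise p G i i = 0 := by
  simp [noise, modelMatrix, adjacency]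

theorem abs_noise_le (hp0 : 0 ≤ p) (hp1 : p ≤ 1) (G : SimpleGraph (Fin n)) (i j : Fin n) :
    |noise p G i j| ≤ 1 := by
  have h := modelMatrix_mem_Icc (n := n) hp0 hp1 i j
  have h2 : adjacency G i j ∈ Set.Icc (0 : ℝ) 1 := by
    simp only [adjacency, SimpleGraph.adjMatrix_apply]
    split_ifs <;> simp
  rw [noise, Matrix.sub_apply, abs_le]
  constructor <;> linarith [h.1, h.2, h2.1, h2.2]

/-- The unordered pair `{i, j}`, listed increasingly. -/
def increasingPair {i j : Fin n} (h : i ≠ j) : {e : Fin n × Fin n // e.1 < e.2} :=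
  ⟨(min i j, max i j), min_lt_max.2 h⟩

theorem increasingPair_inj {i j k l : Fin n} {h : i ≠ j} {h' : k ≠ l}
    (he : increasingPair h = increasingPair h') : i = k ∧ j = l ∨ i = l ∧ j = k := by
  simp only [increasingPair, Subtype.mk.injEq, Prod.mk.injEq, Fin.ext_iff, Fin.coe_min,
    Fin.coe_max] at he ⊢
  omega

theorem increasingPair_right_inj {i j k : Fin n} {h : i ≠ j} {h' : i ≠ k}
    (he : increasingPair h = increasingPair h') : j = k := by
  rcases increasingPair_inj he with ⟨-, h⟩ | ⟨h1, h2⟩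
  · exact h
  · exact h2.trans h1

theorem noise_increasingPair (G : SimpleGraph (Fin n)) {i j : Fin n} (h : i ≠ j) :
    noise p G (increasingPair h).1.1 (increasingPair h).1.2 = noise p G i j := by
  rcases lt_or_gt_of_ne h with h' | h'
  · simp [increasingPair, min_eq_left h'.le, max_eq_right h'.le]
  · simp [increasingPair, min_eq_right h'.le, max_eq_left h'.le, noise_comm G j i]

omit [MeasurableSpace Ω] in
theorem noise_eq_indicator (G : Ω → SimpleGraph (Fin n)) (i j : Fin n) (ω : Ω) :
    noise p (G ω) i j =
      {ω | (G ω).Adj i j}.indicator (fun _ => (1 : ℝ)) ω - modelMatrix n p i j := by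
  classical
  simp [noise, adjacency, SimpleGraph.adjMatrix_apply, Set.indicator_apply]

theorem IsRandomLinearGraph.measurable_noise (h : IsRandomLinearGraph p G P) (i j : Fin n) :
    Measurable fun ω => noise p (G ω) i j := by
  simp only [noise_eq_indicator]
  exact (measurable_const.indicator (h.measurableSet_adj i j)).sub_const _

theorem IsRandomLinearGraph.integral_noise [IsProbabilityMeasure P]
    (h : IsRandomLinearGraph p G P) {i j : Fin n} (hij : i < j) :
    ∫ ω, noise p (G ω) i j ∂P = 0 := by
  simp only [noise_eq_indicator]
  rw [integral_sub ((integrable_const _).indicator (h.measurableSet_adj i j)) (integrable_const _),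
    integral_indicator (h.measurableSet_adj i j), ← h.prob_adj i j hij]
  simp

theorem IsRandomLinearGraph.iIndepFun_noise (h : IsRandomLinearGraph p G P) :
    iIndepFun (fun (e : {e : Fin n × Fin n // e.1 < e.2}) ω => noise p (G ω) e.1.1 e.1.2) P := by
  simp only [noise_eq_indicator]
  exact (h.indep.iIndepFun_indicator (β := ℝ)).comp
    (fun e x => x - modelMatrix n p e.1.1 e.1.2) fun e => measurable_id.sub_const _

/-- The constant `12` makes the tail `O(n⁻⁶)`, which leaves room for a union bound over `n ^ 2 + n`
events within a total probability of `n⁻³`. -/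
theorem measureReal_sqrt_log_lt_abs_le [IsProbabilityMeasure P] {X : Ω → ℝ} {m n : ℕ}
    (h : HasSubgaussianMGF X m P) (hm : m ≤ n) (hn : 1 ≤ n) (hm0 : 1 ≤ m) :
    P.real {ω | √(12 * n * Real.log n) < |X ω|} ≤ 2 / (n : ℝ) ^ 6 := by
  have hn' : (1 : ℝ) ≤ n := by exact_mod_cast hn
  have hm' : (m : ℝ) ≤ n := by exact_mod_cast hm
  have hm0' : (1 : ℝ) ≤ m := by exact_mod_cast hm0
  have hlog := Real.log_nonneg hn'
  have hs : {ω | √(12 * n * Real.log n) < |X ω|} ⊆ {ω | √(12 * n * Real.log n) ≤ |X ω|} :=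
    Set.ofPred_subset_ofPred.2 fun ω hω => hω.le
  refine (measureReal_mono hs).trans ((measureReal_le_abs_le h (Real.sqrt_nonneg _)).trans ?_)
  have h1 : Real.exp (-(6 * Real.log n)) = 1 / (n : ℝ) ^ 6 := by
    rw [Real.exp_neg, mul_comm, Real.exp_mul, Real.exp_log (by linarith), one_div]
    norm_cast
  rw [show 2 / (n : ℝ) ^ 6 = 2 * (1 / (n : ℝ) ^ 6) by ring, ← h1]
  gcongr
  rw [Real.sq_sqrt (by positivity), neg_div]
  rw [neg_le_neg_iff, le_div_iff₀ (by push_cast; linarith)]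
  push_cast
  nlinarith [mul_le_mul_of_nonneg_right hm' hlog]

theorem sum_noise_mul_eq (G : SimpleGraph (Fin n)) (i : Fin n) (f : Fin n → ℝ) :
    ∑ j, noise p G i j * f j = ∑ j : {j // i ≠ j}, noise p G i j * f j := by
  rw [← Finset.sum_subtype (p := fun j => i ≠ j) (Finset.univ.filter fun j => i ≠ j) (by simp)
    (fun j => noise p G i j * f j), Finset.sum_filter_of_ne]
  rintro j _ hj rfl
  simp [noise_self] at hj

/-- With high probability, `E f` is of size `√(n log n)` in each coordinate, for the noise matrix
`E` and a fixed bounded vector `f`, and so is each entry of `E ^ 2` off the diagonal. -/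
theorem IsRandomLinearGraph.measureReal_noise_large_le [IsProbabilityMeasure P]
    (h : IsRandomLinearGraph p G P) (hp0 : 0 ≤ p) (hp1 : p ≤ 1) (hn : 3 ≤ n) {f : Fin n → ℝ}
    (hf : ∀ j, |f j| ≤ 1) :
    P.real {ω | ¬ ((∀ i, |∑ j, noise p (G ω) i j * f j| ≤ √(12 * n * Real.log n)) ∧
      ∀ i j, i ≠ j →
        |∑ k, noise p (G ω) i k * noise p (G ω) j k| ≤ √(12 * n * Real.log n))} ≤
      1 / (n : ℝ) ^ 3 := by
  set X : {e : Fin n × Fin n // e.1 < e.2} → Ω → ℝ :=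
    fun e ω => noise p (G ω) e.1.1 e.1.2 with hXdef
  have hX : iIndepFun X P := h.iIndepFun_noise
  have hXm : ∀ e, Measurable (X e) := fun e => h.measurable_noise _ _
  have hXb : ∀ e ω, |X e ω| ≤ 1 := fun e ω => abs_noise_le hp0 hp1 _ _ _
  have hX0 : ∀ e, ∫ ω, X e ω ∂P = 0 := fun e => h.integral_noise e.2
  have hXe : ∀ {i j : Fin n} (hij : i ≠ j) ω, X (increasingPair hij) ω = noise p (G ω) i j :=
    fun hij ω => noise_increasingPair _ hij
  set t := √(12 * n * Real.log n) with ht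
  have h1 : ∀ i, P.real {ω | t < |∑ j, noise p (G ω) i j * f j|} ≤ 2 / (n : ℝ) ^ 6 := by
    intro i
    have hinj : Function.Injective fun j : {j // i ≠ j} => increasingPair j.2 := by
      intro j k hjk
      exact Subtype.ext (increasingPair_right_inj hjk)
    have hs := hasSubgaussianMGF_weighted_sum hX hXm hXb hX0 hinj
      (f := fun j : {j // i ≠ j} => f j) (fun j => hf _) Finset.univ
    simp only [hXe] at hs
    have hcard : (Finset.univ : Finset {j // i ≠ j}).card = n - 1 := by
      rw [Finset.card_univ, Fintype.card_subtype]
      simp [Finset.filter_ne]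
    rw [hcard] at hs
    have := measureReal_sqrt_log_lt_abs_le hs (n := n) (by omega) (by omega)
      (by omega)
    convert this using 5 with ω
    rw [sum_noise_mul_eq]
  have h2 : ∀ i j, i ≠ j →
      P.real {ω | t < |∑ k, noise p (G ω) i k * noise p (G ω) j k|} ≤ 2 / (n : ℝ) ^ 6 := by
    intro i j hij
    have hinj1 : Function.Injective fun k : {k // i ≠ k ∧ j ≠ k} => increasingPair k.2.1 := by
      intro k l hkl
      exact Subtype.ext (increasingPair_right_inj hkl)
    have hinj2 : Function.Injective fun k : {k // i ≠ k ∧ j ≠ k} => increasingPair k.2.2 := by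
      intro k l hkl
      exact Subtype.ext (increasingPair_right_inj hkl)
    have hne : ∀ k l : {k // i ≠ k ∧ j ≠ k}, increasingPair k.2.1 ≠ increasingPair l.2.2 := by
      intro k l hkl
      rcases increasingPair_inj hkl with ⟨h, -⟩ | ⟨h, -⟩
      · exact hij h
      · exact l.2.1 h
    have hs := hasSubgaussianMGF_sum_mul hX hXm hXb hX0 hinj1 hinj2 hne Finset.univ
    simp only [hXe] at hs
    have hcard : (Finset.univ : Finset {k // i ≠ k ∧ j ≠ k}).card = n - 2 := by
      rw [Finset.card_univ, Fintype.card_subtype]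
      have : (Finset.univ.filter fun k => i ≠ k ∧ j ≠ k) =
          (Finset.univ : Finset (Fin n)) \ {i, j} := by
        ext k; simp [eq_comm]
      rw [this, Finset.card_sdiff_of_subset (by simp), Finset.card_pair hij, Finset.card_univ,
        Fintype.card_fin]
    rw [hcard] at hs
    have := measureReal_sqrt_log_lt_abs_le hs (n := n) (by omega) (by omega)
      (by omega)
    convert this using 5 with ω
    rw [← Finset.sum_subtype (p := fun k => i ≠ k ∧ j ≠ k)
      (Finset.univ.filter fun k => i ≠ k ∧ j ≠ k) (by simp)
      (fun k => noise p (G ω) i k * noise p (G ω) j k), Finset.sum_filter_of_ne]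
    intro k _ hk
    constructor
    · rintro rfl; simp [noise_self] at hk
    · rintro rfl; simp [noise_self] at hk
  have hsub : {ω | ¬ ((∀ i, |∑ j, noise p (G ω) i j * f j| ≤ t) ∧
      ∀ i j, i ≠ j → |∑ k, noise p (G ω) i k * noise p (G ω) j k| ≤ t)} ⊆
      (⋃ i, {ω | t < |∑ j, noise p (G ω) i j * f j|}) ∪
      ⋃ e : Fin n × Fin n, {ω | e.1 ≠ e.2 ∧
        t < |∑ k, noise p (G ω) e.1 k * noise p (G ω) e.2 k|} := by
    intro ω hω
    simp only [Set.mem_union, Set.mem_iUnion, Set.mem_ofPred_eq] at hω ⊢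
    by_contra hc
    push Not at hc
    exact hω ⟨hc.1, fun i j hij => hc.2 (i, j) hij⟩
  have hn' : (3 : ℝ) ≤ n := by exact_mod_cast hn
  have h3 : ∀ e : Fin n × Fin n, P.real {ω | e.1 ≠ e.2 ∧
      t < |∑ k, noise p (G ω) e.1 k * noise p (G ω) e.2 k|} ≤ 2 / (n : ℝ) ^ 6 := by
    intro e
    by_cases he : e.1 = e.2
    · simp [he]; positivity
    · refine (measureReal_mono ?_).trans (h2 _ _ he)
      exact fun ω hω => hω.2
  calc _ ≤ _ := measureReal_mono hsub
    _ ≤ _ := measureReal_union_le _ _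
    _ ≤ ∑ i : Fin n, 2 / (n : ℝ) ^ 6 + ∑ e : Fin n × Fin n, 2 / (n : ℝ) ^ 6 :=
      add_le_add ((measureReal_iUnion_fintype_le _).trans (Finset.sum_le_sum fun i _ => h1 i))
        ((measureReal_iUnion_fintype_le _).trans (Finset.sum_le_sum fun e _ => h3 e))
    _ ≤ 1 / (n : ℝ) ^ 3 := by
      simp only [Finset.sum_const, Finset.card_univ, Fintype.card_prod, Fintype.card_fin,
        nsmul_eq_mul, Nat.cast_mul]
      rw [← add_mul, mul_div_assoc', div_le_div_iff₀ (by positivity) (by positivity)]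
      have : 0 ≤ (n : ℝ) ^ 4 * (n ^ 2 - 2 * n - 2 : ℝ) - (n : ℝ) ^ 4 * 0 := by
        have : 0 ≤ (n : ℝ) ^ 2 - 2 * n - 2 := by nlinarith
        simp; positivity
      nlinarith [pow_pos (show (0 : ℝ) < n by linarith) 4]

end Noise

/-! ### The sampled cosine -/

section Cosine

theorem two_mul_sin_mul_sum_cos (θ : ℝ) {a b : ℕ} (hab : a ≤ b) :
    2 * Real.sin (θ / 2) * ∑ j ∈ Finset.Ico a b, Real.cos (θ * (j + 1 / 2)) =
      Real.sin (θ * b) - Real.sin (θ * a) := by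
  induction b, hab using Nat.le_induction with
  | base => simp
  | succ b hb ih =>
    rw [Finset.sum_Ico_succ_top hb, mul_add, ih]
    have h1 : θ * ((b + 1 : ℕ) : ℝ) = θ * (b + 1 / 2) + θ / 2 := by push_cast; ring
    have h2 : θ * (b : ℝ) = θ * (b + 1 / 2) - θ / 2 := by ring
    rw [h1, h2, Real.sin_add, Real.sin_sub]
    ring

/-- The sampled half-period of the cosine. The function `cos (π x)` is the second eigenfunction of
the kernel `1_{|x - y| ≤ 1/2}` on `[0, 1]`, the continuum limit of the model matrix. -/
noncomputable def cosVec (n : ℕ) : Fin n → ℝ := fun j => Real.cos (Real.pi / n * (j + 1 / 2))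

theorem abs_cosVec_le {n : ℕ} (j : Fin n) : |cosVec n j| ≤ 1 := Real.abs_cos_le_one _

theorem sum_cosVec {n : ℕ} (hn : 1 ≤ n) : ∑ j, cosVec n j = 0 := by
  have hn' : (1 : ℝ) ≤ n := by exact_mod_cast hn
  have h := two_mul_sin_mul_sum_cos (Real.pi / n) (Nat.zero_le n)
  rw [div_mul_cancel₀ _ (by positivity)] at h
  simp only [Real.sin_pi, Nat.cast_zero, mul_zero, Real.sin_zero, sub_zero, mul_eq_zero] at h
  have hs : 0 < Real.sin (Real.pi / n / 2) := by
    refine Real.sin_pos_of_pos_of_lt_pi (by positivity) ?_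
    have : Real.pi / n ≤ Real.pi := div_le_self Real.pi_pos.le hn'
    linarith [Real.pi_pos]
  have h' := h.resolve_left (by simp [hs.ne'])
  rw [← h', ← Finset.range_eq_Ico, ← Fin.sum_univ_eq_sum_range
    (fun j => Real.cos (Real.pi / n * ((j : ℝ) + 1 / 2)))]
  rfl

theorem sum_sq_cosVec {n : ℕ} (hn : 2 ≤ n) : ∑ j, cosVec n j ^ 2 = n / 2 := by
  have hn' : (2 : ℝ) ≤ n := by exact_mod_cast hn
  have h := two_mul_sin_mul_sum_cos (2 * Real.pi / n) (Nat.zero_le n)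
  rw [div_mul_cancel₀ _ (by positivity)] at h
  simp only [Real.sin_two_pi, Nat.cast_zero, mul_zero, Real.sin_zero, sub_zero, mul_eq_zero] at h
  have hs : 0 < Real.sin (2 * Real.pi / n / 2) := by
    refine Real.sin_pos_of_pos_of_lt_pi (by positivity) ?_
    rw [div_div, div_lt_iff₀ (by positivity)]
    nlinarith [Real.pi_pos]
  have h' := h.resolve_left (by simp [hs.ne'])
  rw [← Finset.range_eq_Ico, ← Fin.sum_univ_eq_sum_range
    (fun j => Real.cos (2 * Real.pi / n * ((j : ℝ) + 1 / 2)))] at h'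
  have e : ∀ j : Fin n, cosVec n j ^ 2 =
      1 / 2 + Real.cos (2 * Real.pi / n * ((j : ℝ) + 1 / 2)) / 2 := by
    intro j
    rw [cosVec, Real.cos_sq]
    congr 3
    ring
  simp only [e, Finset.sum_add_distrib, ← Finset.sum_div, h']
  simp [div_eq_mul_inv]

/-- The sampled cosine decreases at least quadratically. Near the two ends of the interval no
better rate is available. -/
theorem two_mul_sq_le_cosVec_sub {n : ℕ} {a b : Fin n} (hab : a < b) :
    2 * (((b : ℝ) - a) / n) ^ 2 ≤ cosVec n a - cosVec n b := by
  have hn : (0 : ℝ) < n := by exact_mod_cast (Nat.zero_le _).trans_lt a.2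
  have hab' : (a : ℝ) < b := by exact_mod_cast hab
  have hb : (b : ℝ) + 1 ≤ n := by exact_mod_cast b.2
  have ha : (0 : ℝ) ≤ a := by positivity
  have hpi := Real.pi_pos
  set u := ((b : ℝ) - a) / n with hu
  have hu0 : 0 ≤ u := div_nonneg (by linarith) hn.le
  have hu1 : u ≤ 1 := by rw [hu, div_le_one hn]; linarith
  have hsin : u ≤ Real.sin (Real.pi / 2 * u) := by
    have := Real.mul_le_sin (x := Real.pi / 2 * u) (by positivity) (by nlinarith)
    have e : 2 / Real.pi * (Real.pi / 2 * u) = u := by field_simp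
    rwa [e] at this
  set s := ((a : ℝ) + b + 1) / n with hs
  have hus : u ≤ s := by rw [hu, hs]; gcongr; linarith
  have hus2 : s ≤ 2 - u := by
    rw [hu, hs, le_sub_iff_add_le, ← add_div, div_le_iff₀ hn]; linarith
  have hsin2 : Real.sin (Real.pi / 2 * u) ≤ Real.sin (Real.pi / 2 * s) := by
    rcases le_total s 1 with h | h
    · exact Real.sin_le_sin_of_le_of_le_pi_div_two (by nlinarith) (by nlinarith) (by nlinarith)
    · rw [← Real.sin_pi_sub (Real.pi / 2 * s)]
      exact Real.sin_le_sin_of_le_of_le_pi_div_two (by nlinarith) (by nlinarith) (by nlinarith)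
  have hcos : cosVec n a - cosVec n b =
      2 * Real.sin (Real.pi / 2 * s) * Real.sin (Real.pi / 2 * u) := by
    rw [cosVec, cosVec, Real.cos_sub_cos]
    have e1 : (Real.pi / n * ((a : ℝ) + 1 / 2) + Real.pi / n * ((b : ℝ) + 1 / 2)) / 2 =
        Real.pi / 2 * s := by rw [hs]; field_simp; ring
    have e2 : (Real.pi / n * ((a : ℝ) + 1 / 2) - Real.pi / n * ((b : ℝ) + 1 / 2)) / 2 =
        -(Real.pi / 2 * u) := by rw [hu]; field_simp; ring
    rw [e1, e2, Real.sin_neg]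
    ring
  rw [hcos]
  nlinarith

end Cosine

/-! ### The model matrix -/

section Model

variable {n : ℕ} {p : ℝ}

theorem abs_sub_le_half_iff (i j n : ℕ) :
    |(i : ℝ) - j| ≤ (n : ℝ) / 2 ↔ i - n / 2 ≤ j ∧ j < i + n / 2 + 1 := by
  have h1 : (i : ℝ) - j ≤ (n : ℝ) / 2 ↔ 2 * i ≤ n + 2 * j := by
    rw [← Nat.cast_le (α := ℝ)]; push_cast; constructor <;> intro h <;> linarith
  have h2 : -((n : ℝ) / 2) ≤ (i : ℝ) - j ↔ 2 * j ≤ n + 2 * i := by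
    rw [← Nat.cast_le (α := ℝ)]; push_cast; constructor <;> intro h <;> linarith
  rw [abs_le, h1, h2]
  omega

/-- A row of the model matrix is `p` times the indicator of an interval, without the diagonal. -/
theorem sum_modelMatrix_mul (i : Fin n) (g : ℕ → ℝ) :
    ∑ j : Fin n, modelMatrix n p i j * g j =
      p * (∑ j ∈ Finset.Ico (i - n / 2 : ℕ) (min n (i + n / 2 + 1)), g j - g i) := by
  have e : ∀ j : Fin n, modelMatrix n p i j * g j =
      (if (j : ℕ) ∈ Finset.Ico (i - n / 2 : ℕ) (i + n / 2 + 1) then p * g j else 0) -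
        if i = j then p * g j else 0 := by
    intro j
    simp only [modelMatrix, abs_sub_le_half_iff, Finset.mem_Ico]
    by_cases h : i = j
    · subst h; simp
    · simp [h]
  simp only [e, Finset.sum_sub_distrib, Finset.sum_ite_eq, Finset.mem_univ, if_true]
  rw [Fin.sum_univ_eq_sum_range (fun j : ℕ =>
    if j ∈ Finset.Ico (i - n / 2 : ℕ) (i + n / 2 + 1) then p * g j else 0), ← Finset.sum_filter,
    mul_sub, Finset.mul_sum]
  congr 1
  refine Finset.sum_congr ?_ fun _ _ => rfl
  ext j
  simp only [Finset.mem_filter, Finset.mem_range, Finset.mem_Ico]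
  omega

/-- The approximate second eigenvalue of the model matrix. -/
noncomputable def modelEigenvalue (n : ℕ) (p : ℝ) : ℝ := p / (2 * Real.sin (Real.pi / n / 2))

theorem modelEigenvalue_bounds (hn : 1 ≤ n) (hp : 0 ≤ p) :
    p * n / Real.pi ≤ modelEigenvalue n p ∧ modelEigenvalue n p ≤ p * n / 2 := by
  have hn' : (1 : ℝ) ≤ n := by exact_mod_cast hn
  have hpi := Real.pi_pos
  have hle : Real.pi / n / 2 ≤ Real.pi / 2 := by
    have : Real.pi / n ≤ Real.pi := div_le_self hpi.le hn'
    linarith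
  have h1 : 1 / n ≤ Real.sin (Real.pi / n / 2) := by
    have := Real.mul_le_sin (x := Real.pi / n / 2) (by positivity) hle
    have e : 2 / Real.pi * (Real.pi / n / 2) = 1 / n := by field_simp
    rwa [e] at this
  have h2 : Real.sin (Real.pi / n / 2) ≤ Real.pi / n / 2 := Real.sin_le (by positivity)
  have h0 : 0 < Real.sin (Real.pi / n / 2) := lt_of_lt_of_le (by positivity) h1
  unfold modelEigenvalue
  constructor
  · rw [div_le_div_iff₀ hpi (by positivity)]
    have : n * (2 * Real.sin (Real.pi / n / 2)) ≤ Real.pi := by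
      calc n * (2 * Real.sin (Real.pi / n / 2)) ≤ n * (2 * (Real.pi / n / 2)) := by gcongr
        _ = Real.pi := by field_simp
    nlinarith
  · rw [div_le_div_iff₀ (by positivity) (by positivity)]
    have : 1 ≤ n * Real.sin (Real.pi / n / 2) := by
      calc 1 = n * (1 / n : ℝ) := by field_simp
        _ ≤ _ := by gcongr
    nlinarith

/-- The sampled cosine is an eigenvector of the model matrix up to a bounded error. -/
theorem abs_modelMatrix_mulVec_cosVec_sub_le (hp : 0 ≤ p) (i : Fin n) :
    |(modelMatrix n p *ᵥ cosVec n) i - modelEigenvalue n p * cosVec n i| ≤ 2 * p := by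
  have hn : 1 ≤ n := (Nat.zero_le _).trans_lt i.2
  have hn' : (1 : ℝ) ≤ n := by exact_mod_cast hn
  have hpi := Real.pi_pos
  have hi : (i : ℕ) < n := i.2
  set θ := Real.pi / n with hθ
  have hθn : θ * n = Real.pi := by rw [hθ]; field_simp
  set a := (i - n / 2 : ℕ) with ha
  set b := min n (i + n / 2 + 1) with hb
  have hab : a ≤ b := by omega
  have hsum := two_mul_sin_mul_sum_cos θ hab
  have hrow := sum_modelMatrix_mul (p := p) i fun j => Real.cos (θ * ((j : ℝ) + 1 / 2))
  have hθ2 : 0 < Real.sin (θ / 2) := by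
    refine Real.sin_pos_of_pos_of_lt_pi (by positivity) ?_
    have : θ ≤ Real.pi := div_le_self hpi.le hn'
    linarith
  -- The sine terms combine to a sine at a point within `1 / 2` of the required one.
  have hshift : |Real.sin (θ * b) - Real.sin (θ * a) - cosVec n i| ≤ θ / 2 := by
    have hc : cosVec n i = Real.sin (θ * (i + 1 / 2 + n / 2)) := by
      rw [show cosVec n i = Real.cos (θ * (i + 1 / 2)) from rfl, ← Real.sin_add_pi_div_two, ← hθn]
      congr 1
      ring
    have hlip : ∀ x y : ℝ, |x - y| ≤ 1 / 2 → |Real.sin (θ * x) - Real.sin (θ * y)| ≤ θ / 2 := by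
      intro x y hxy
      calc |Real.sin (θ * x) - Real.sin (θ * y)| ≤ |θ * x - θ * y| :=
            Real.abs_sin_sub_sin_le _ _
        _ = θ * |x - y| := by rw [← mul_sub, abs_mul, abs_of_pos (by positivity)]
        _ ≤ θ / 2 := by nlinarith [show 0 < θ by positivity]
    have hm1 : ((n / 2 : ℕ) : ℝ) ≤ n / 2 := by
      rw [le_div_iff₀ two_pos]; exact_mod_cast Nat.div_mul_le_self n 2
    have hm2 : (n : ℝ) ≤ 2 * (n / 2 : ℕ) + 1 := by
      have : n ≤ 2 * (n / 2) + 1 := by omega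
      exact_mod_cast this
    rw [hc]
    rcases le_or_gt (i + n / 2 + 1) n with h | h
    · have ha0 : a = 0 := by omega
      have hb0 : b = i + n / 2 + 1 := by omega
      rw [ha0, hb0]
      simp only [Nat.cast_zero, mul_zero, Real.sin_zero, sub_zero]
      refine hlip _ _ ?_
      push_cast
      rw [abs_le]; constructor <;> linarith
    · have hb0 : b = n := by omega
      have ha0 : (a : ℝ) = i - (n / 2 : ℕ) := by
        rw [ha, Nat.cast_sub (by omega)]
      rw [hb0, hθn, Real.sin_pi, zero_sub, ← Real.sin_add_pi, ha0, ← hθn, ← mul_add]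
      refine hlip _ _ ?_
      rw [abs_le]; constructor <;> linarith
  have hMf : (modelMatrix n p *ᵥ cosVec n) i =
      p * ((Real.sin (θ * b) - Real.sin (θ * a)) / (2 * Real.sin (θ / 2)) - cosVec n i) := by
    rw [← hsum, mul_div_cancel_left₀ _ (by positivity)]
    exact hrow
  have hl := (modelEigenvalue_bounds hn hp).2
  have hl0 : 0 ≤ modelEigenvalue n p := by unfold modelEigenvalue; positivity
  have e : (modelMatrix n p *ᵥ cosVec n) i - modelEigenvalue n p * cosVec n i =
      modelEigenvalue n p * (Real.sin (θ * b) - Real.sin (θ * a) - cosVec n i) -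
        p * cosVec n i := by
    rw [hMf, show modelEigenvalue n p = p / (2 * Real.sin (θ / 2)) from rfl]
    field_simp
    ring
  rw [e]
  have h1 : |p * cosVec n i| ≤ p := by
    rw [abs_mul, abs_of_nonneg hp]
    exact mul_le_of_le_one_right hp (abs_cosVec_le i)
  have h2 : |modelEigenvalue n p * (Real.sin (θ * b) - Real.sin (θ * a) - cosVec n i)| ≤ p := by
    rw [abs_mul, abs_of_nonneg hl0]
    calc _ ≤ p * n / 2 * (θ / 2) := by gcongr
      _ = p * (Real.pi / 4) := by rw [← hθn]; ring
      _ ≤ p := mul_le_of_le_one_right hp (by linarith [Real.pi_le_four])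
  refine (abs_sub _ _).trans ?_
  linarith

theorem sq_le_four_mul_sum_min (n : ℕ) :
    n ^ 2 ≤ 4 * ∑ i ∈ Finset.range n, min i (n - 1 - i) + 2 * n := by
  induction n using Nat.twoStepInduction with
  | zero => simp
  | one => simp
  | more n ih _ =>
    rw [Finset.sum_range_succ, Finset.sum_range_succ']
    have e : ∑ i ∈ Finset.range n, min (i + 1) (n + 2 - 1 - (i + 1)) =
        ∑ i ∈ Finset.range n, (min i (n - 1 - i) + 1) := by
      refine Finset.sum_congr rfl fun i hi => ?_
      have := Finset.mem_range.1 hi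
      omega
    rw [e, Finset.sum_add_distrib]
    simp
    nlinarith

theorem le_sum_modelMatrix (hp : 0 ≤ p) :
    p * (3 / 4 * n ^ 2 - n) ≤ ∑ i, ∑ j, modelMatrix n p i j := by
  have hrow : ∀ i : Fin n, p * ((n / 2 : ℕ) + min (i : ℕ) (n - 1 - i) : ℕ) ≤
      ∑ j, modelMatrix n p i j := by
    intro i
    have h := sum_modelMatrix_mul (p := p) i fun _ => 1
    simp only [mul_one] at h
    rw [h]
    refine mul_le_mul_of_nonneg_left ?_ hp
    rw [Finset.sum_const, Nat.card_Ico, nsmul_one, le_sub_iff_add_le]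
    have := i.2
    norm_cast
    omega
  refine le_trans ?_ (Finset.sum_le_sum fun i _ => hrow i)
  rw [← Finset.mul_sum]
  refine mul_le_mul_of_nonneg_left ?_ hp
  rw [Fin.sum_univ_eq_sum_range (fun i : ℕ => ((n / 2 + min i (n - 1 - i) : ℕ) : ℝ)),
    ← Nat.cast_sum, Finset.sum_add_distrib]
  have h1 := sq_le_four_mul_sum_min n
  have h2 : n ≤ 2 * (n / 2) + 1 := by omega
  have h1' : (n : ℝ) ^ 2 ≤ 4 * ((∑ i ∈ Finset.range n, min i (n - 1 - i) : ℕ) : ℝ) + 2 * n := by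
    exact_mod_cast h1
  have h2' : (n : ℝ) ≤ 2 * ((n / 2 : ℕ) : ℝ) + 1 := by exact_mod_cast h2
  rw [Nat.cast_add]
  simp only [Finset.sum_const, Finset.card_range, smul_eq_mul, Nat.cast_mul]
  nlinarith [show (0 : ℝ) ≤ n by positivity]

theorem dotProduct_mulVec_sq_le (A : Matrix (Fin n) (Fin n) ℝ) (z : Fin n → ℝ) :
    (z ⬝ᵥ A *ᵥ z) ^ 2 ≤ (∑ i, ∑ j, A i j ^ 2) * (z ⬝ᵥ z) ^ 2 := by
  have h := Finset.sum_mul_sq_le_sq_mul_sq (Finset.univ : Finset (Fin n × Fin n))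
    (fun e => A e.1 e.2) fun e => z e.1 * z e.2
  have e1 : ∑ e : Fin n × Fin n, A e.1 e.2 * (z e.1 * z e.2) = z ⬝ᵥ A *ᵥ z := by
    simp only [Fintype.sum_prod_type, dotProduct, mulVec, Finset.mul_sum]
    exact Finset.sum_congr rfl fun i _ => Finset.sum_congr rfl fun j _ => by ring
  have e2 : ∑ e : Fin n × Fin n, (z e.1 * z e.2) ^ 2 = (z ⬝ᵥ z) ^ 2 := by
    simp only [Fintype.sum_prod_type, dotProduct, sq, Finset.sum_mul_sum]
    exact Finset.sum_congr rfl fun i _ => Finset.sum_congr rfl fun j _ => by ring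
  rw [e1, e2] at h
  simpa only [Fintype.sum_prod_type] using h

/-- Apart from the constant vector and the sampled cosine, the model matrix is small. The
Frobenius norm is what is left of `‖M‖² ≈ (3/4) (p n)²` after removing the squares of the two
Rayleigh quotients, about `(9/16 + 1/π²) (p n)²`. -/
theorem modelMatrix_frobenius_le (hn : 6000 ≤ n) (hp : 0 ≤ p) :
    ∑ i, ∑ j, (modelMatrix n p i j - 3 / 4 * p -
      2 * modelEigenvalue n p / n * (cosVec n i * cosVec n j)) ^ 2 ≤ (0.295 * (p * n)) ^ 2 := by
  have hn' : (6000 : ℝ) ≤ n := by exact_mod_cast hn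
  set M := modelMatrix n p
  set f := cosVec n
  set l := modelEigenvalue n p
  set S := ∑ i, ∑ j, M i j with hS
  set D := ∑ i, f i * (M *ᵥ f) i with hD
  have hM2 : ∀ i j, M i j ^ 2 = p * M i j := by
    intro i j
    simp only [M, modelMatrix]
    split_ifs <;> ring
  have hf0 : ∑ i, f i = 0 := sum_cosVec (by omega)
  have hf2 : ∑ i, f i ^ 2 = n / 2 := sum_sq_cosVec (by omega)
  have hexp : ∑ i, ∑ j, (M i j - 3 / 4 * p - 2 * l / n * (f i * f j)) ^ 2 =
      p * S + (3 / 4 * p) ^ 2 * n ^ 2 + (2 * l / n) ^ 2 * (n / 2) ^ 2 - 3 / 2 * p * S -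
        2 * (2 * l / n) * D := by
    have e1 : ∀ i j, (M i j - 3 / 4 * p - 2 * l / n * (f i * f j)) ^ 2 =
        -(1 / 2 * p) * M i j + (3 / 4 * p) ^ 2 + (2 * l / n) ^ 2 * (f i ^ 2 * f j ^ 2) -
          2 * (2 * l / n) * (f i * (M i j * f j)) +
          2 * (3 / 4 * p) * (2 * l / n) * (f i * f j) := by
      intro i j
      linear_combination hM2 i j
    simp only [e1, Finset.sum_add_distrib, Finset.sum_sub_distrib, ← Finset.mul_sum, hf0, hf2,
      ← Finset.sum_mul]
    simp only [hD, hS, mulVec, dotProduct, Finset.sum_const, Finset.card_univ, Fintype.card_fin,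
      nsmul_eq_mul]
    ring
  have hSle := le_sum_modelMatrix (n := n) hp
  have hDle : l * (n / 2) - 2 * p * n ≤ D := by
    have : ∀ i, l * f i ^ 2 - 2 * p ≤ f i * (M *ᵥ f) i := by
      intro i
      have h1 := abs_modelMatrix_mulVec_cosVec_sub_le hp i
      have h2 : |f i * ((M *ᵥ f) i - l * f i)| ≤ 2 * p := by
        rw [abs_mul]
        exact (mul_le_of_le_one_left (abs_nonneg _) (abs_cosVec_le i)).trans h1
      have := (abs_le.1 h2).1
      nlinarith
    calc l * (n / 2) - 2 * p * n = ∑ i, (l * f i ^ 2 - 2 * p) := by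
          rw [Finset.sum_sub_distrib, ← Finset.mul_sum, hf2]
          simp; ring
      _ ≤ D := Finset.sum_le_sum fun i _ => this i
  obtain ⟨hl1, hl2⟩ := modelEigenvalue_bounds (n := n) (by omega) hp
  rw [hexp]
  have hl3 : 0.3183 * (p * n) ≤ l := by
    refine le_trans ?_ hl1
    rw [le_div_iff₀ Real.pi_pos]
    have : 0 ≤ p * n := by positivity
    nlinarith [Real.pi_lt_d4]
  have hpn : 0 ≤ p * n := by positivity
  have h1 : (2 * l / n) ^ 2 * (n / 2) ^ 2 = l ^ 2 := by field_simp
  have h2 : 2 * l ^ 2 - 8 * p * l ≤ 2 * (2 * l / n) * D := by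
    calc 2 * l ^ 2 - 8 * p * l = 2 * (2 * l / n) * (l * (n / 2) - 2 * p * n) := by
          field_simp; ring
      _ ≤ _ := by
        have : 0 ≤ l := le_trans (by positivity) hl3
        gcongr
  have h3 : (0.3183 * (p * n)) ^ 2 ≤ l ^ 2 := pow_le_pow_left₀ (by positivity) hl3 2
  have h4 : p * (p * (3 / 4 * n ^ 2 - n)) ≤ p * S := mul_le_mul_of_nonneg_left hSle hp
  have h5 : p * l ≤ p * (p * n / 2) := mul_le_mul_of_nonneg_left hl2 hp
  have h6 : 6000 * (p ^ 2 * n) ≤ p ^ 2 * n ^ 2 := by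
    nlinarith [mul_nonneg (sq_nonneg p) (show (0 : ℝ) ≤ n by positivity)]
  rw [h1]
  nlinarith

end Model

/-! ### Counting inversions -/

section Inversions

variable {n : ℕ}

theorem kendallDist_le_card {y : Fin n → ℝ} {σ : Equiv.Perm (Fin n)} (hσ : IsSortingPerm y σ) :
    kendallDist σ ≤
      (Finset.univ.filter fun e : Fin n × Fin n => e.1 < e.2 ∧ y e.1 ≤ y e.2).card := by
  refine Finset.card_le_card_of_injOn (fun e => (σ e.2, σ e.1)) ?_ ?_
  · intro e he
    simp only [Finset.coe_filter, Finset.mem_univ, true_and, Set.mem_ofPred_eq] at he ⊢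
    exact ⟨he.2, hσ _ _ he.1.le⟩
  · intro e _ e' _ h
    simp only [Prod.mk.injEq, EmbeddingLike.apply_eq_iff_eq] at h
    exact Prod.ext h.2 h.1

theorem card_le_of_injOn_nat {α : Type*} {s : Finset α} {d : α → ℕ} (hd : Set.InjOn d s) {r : ℝ}
    (hr : 0 ≤ r) (h1 : ∀ x ∈ s, 1 ≤ d x) (h2 : ∀ x ∈ s, (d x : ℝ) ≤ r) : (s.card : ℝ) ≤ r := by
  have h : s.card ≤ (Finset.Icc 1 ⌊r⌋₊).card :=
    Finset.card_le_card_of_injOn d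
      (fun x hx => Finset.mem_coe.2 (Finset.mem_Icc.2 ⟨h1 x hx, Nat.le_floor (h2 x hx)⟩)) hd
  rw [Nat.card_Icc, Nat.add_sub_cancel] at h
  exact (Nat.cast_le.2 h).trans (Nat.floor_le hr)

theorem card_filter_lt_le (a : Fin n) {r : ℝ} (hr : 0 ≤ r) :
    ((Finset.univ.filter fun b : Fin n => a < b ∧ (b : ℝ) - a ≤ r).card : ℝ) ≤ r := by
  have hlt : ∀ b ∈ Finset.univ.filter fun b : Fin n => a < b ∧ (b : ℝ) - a ≤ r, (a : ℕ) < b :=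
    fun b hb => (Finset.mem_filter.1 hb).2.1
  refine card_le_of_injOn_nat
    (s := Finset.univ.filter fun b : Fin n => a < b ∧ (b : ℝ) - a ≤ r)
    (d := fun b => (b : ℕ) - a) (fun b hb c hc h => ?_) hr
    (fun b hb => ?_) fun b hb => ?_
  · have h1 := hlt b hb
    have h2 := hlt c hc
    ext
    dsimp only at h
    omega
  · have h1 := hlt b hb
    omega
  · rw [Nat.cast_sub (hlt b hb).le]
    exact (Finset.mem_filter.1 hb).2.2

theorem card_filter_gt_le (b : Fin n) {r : ℝ} (hr : 0 ≤ r) :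
    ((Finset.univ.filter fun a : Fin n => a < b ∧ (b : ℝ) - a ≤ r).card : ℝ) ≤ r := by
  have hlt : ∀ a ∈ Finset.univ.filter fun a : Fin n => a < b ∧ (b : ℝ) - a ≤ r, (a : ℕ) < b :=
    fun a ha => (Finset.mem_filter.1 ha).2.1
  refine card_le_of_injOn_nat
    (s := Finset.univ.filter fun a : Fin n => a < b ∧ (b : ℝ) - a ≤ r)
    (d := fun a => (b : ℕ) - a) (fun a ha c hc h => ?_) hr
    (fun a ha => ?_) fun a ha => ?_
  · have h1 := hlt a ha
    have h2 := hlt c hc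
    ext
    dsimp only at h
    omega
  · have h1 := hlt a ha
    omega
  · rw [Nat.cast_sub (hlt a ha).le]
    exact (Finset.mem_filter.1 ha).2.2

/-- A pair inverted in a perturbation of the sampled cosine is so close that its distance is
controlled by the perturbation at one of its two points. -/
theorem sub_le_or_sub_le_of_cosVec_add_le {η : Fin n → ℝ} {a b : Fin n} (hab : a < b)
    (h : cosVec n a + η a ≤ cosVec n b + η b) :
    (b : ℝ) - a ≤ n * √|η a| ∨ (b : ℝ) - a ≤ n * √|η b| := by
  have hn : (0 : ℝ) < n := by exact_mod_cast (Nat.zero_le _).trans_lt a.2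
  have hab' : (a : ℝ) < b := by exact_mod_cast hab
  have h1 := two_mul_sq_le_cosVec_sub hab
  have key : ∀ x : ℝ, (((b : ℝ) - a) / n) ^ 2 ≤ |x| → (b : ℝ) - a ≤ n * √|x| := by
    intro x hx
    have := Real.le_sqrt_of_sq_le hx
    rwa [div_le_iff₀ hn, mul_comm] at this
  have h2 := neg_abs_le (η a)
  have h3 := le_abs_self (η b)
  rcases le_total |η a| |η b| with h4 | h4
  · exact Or.inr (key _ (by linarith))
  · exact Or.inl (key _ (by linarith))

theorem sum_sqrt_abs_pow_four_le (η : Fin n → ℝ) :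
    (∑ i, √|η i|) ^ 4 ≤ n ^ 3 * ∑ i, η i ^ 2 := by
  have h1 := sq_sum_le_card_mul_sum_sq (s := (Finset.univ : Finset (Fin n))) (f := fun i => √|η i|)
  have h2 := sq_sum_le_card_mul_sum_sq (s := (Finset.univ : Finset (Fin n))) (f := fun i => |η i|)
  simp only [Real.sq_sqrt (abs_nonneg _), Finset.card_univ, Fintype.card_fin, sq_abs] at h1 h2
  calc (∑ i, √|η i|) ^ 4 = ((∑ i, √|η i|) ^ 2) ^ 2 := by ring
    _ ≤ (n * ∑ i, |η i|) ^ 2 := pow_le_pow_left₀ (sq_nonneg _) h1 2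
    _ = n ^ 2 * (∑ i, |η i|) ^ 2 := by ring
    _ ≤ n ^ 2 * (n * ∑ i, η i ^ 2) := by gcongr
    _ = n ^ 3 * ∑ i, η i ^ 2 := by ring

/-- Sorting an `ℓ²`-perturbation of a positive multiple of the sampled cosine gives few
inversions. -/
theorem kendallDist_pow_four_le {y η : Fin n → ℝ} {c : ℝ} (hc : 0 < c)
    (hy : ∀ i, y i = c * (cosVec n i + η i)) {σ : Equiv.Perm (Fin n)} (hσ : IsSortingPerm y σ) :
    (kendallDist σ : ℝ) ^ 4 ≤ 16 * n ^ 7 * ∑ i, η i ^ 2 := by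
  have h1 : (Finset.univ.filter fun e : Fin n × Fin n => e.1 < e.2 ∧ y e.1 ≤ y e.2) ⊆
      (Finset.univ.filter fun e : Fin n × Fin n => e.1 < e.2 ∧ (e.2 : ℝ) - e.1 ≤ n * √|η e.1|) ∪
      (Finset.univ.filter fun e : Fin n × Fin n => e.1 < e.2 ∧ (e.2 : ℝ) - e.1 ≤ n * √|η e.2|) := by
    intro e he
    simp only [Finset.mem_filter, Finset.mem_univ, true_and, Finset.mem_union] at he ⊢
    have h := he.2
    rw [hy, hy] at h
    rcases sub_le_or_sub_le_of_cosVec_add_le he.1 (le_of_mul_le_mul_left h hc) with h | h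
    · exact Or.inl ⟨he.1, h⟩
    · exact Or.inr ⟨he.1, h⟩
  have h2 : ((Finset.univ.filter fun e : Fin n × Fin n =>
      e.1 < e.2 ∧ (e.2 : ℝ) - e.1 ≤ n * √|η e.1|).card : ℝ) ≤ n * ∑ i, √|η i| := by
    have e : (Finset.univ.filter fun e : Fin n × Fin n =>
        e.1 < e.2 ∧ (e.2 : ℝ) - e.1 ≤ n * √|η e.1|).card = ∑ a, (Finset.univ.filter
          fun b : Fin n => a < b ∧ (b : ℝ) - a ≤ n * √|η a|).card := by
      simp only [Finset.card_filter, Fintype.sum_prod_type]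
    rw [e, Nat.cast_sum, Finset.mul_sum]
    refine Finset.sum_le_sum fun a _ => ?_
    exact card_filter_lt_le a (by positivity)
  have h3 : ((Finset.univ.filter fun e : Fin n × Fin n =>
      e.1 < e.2 ∧ (e.2 : ℝ) - e.1 ≤ n * √|η e.2|).card : ℝ) ≤ n * ∑ i, √|η i| := by
    have e : (Finset.univ.filter fun e : Fin n × Fin n =>
        e.1 < e.2 ∧ (e.2 : ℝ) - e.1 ≤ n * √|η e.2|).card = ∑ b, (Finset.univ.filter
          fun a : Fin n => a < b ∧ (b : ℝ) - a ≤ n * √|η b|).card := by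
      simp only [Finset.card_filter, Fintype.sum_prod_type_right]
    rw [e, Nat.cast_sum, Finset.mul_sum]
    refine Finset.sum_le_sum fun b _ => ?_
    exact card_filter_gt_le b (by positivity)
  have h4 : (kendallDist σ : ℝ) ≤ 2 * n * ∑ i, √|η i| := by
    have := (kendallDist_le_card hσ).trans ((Finset.card_le_card h1).trans
      (Finset.card_union_le _ _))
    have h5 : (kendallDist σ : ℝ) ≤ _ := Nat.cast_le.2 this
    push_cast at h5
    linarith
  calc (kendallDist σ : ℝ) ^ 4 ≤ (2 * n * ∑ i, √|η i|) ^ 4 := by gcongr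
    _ = 16 * n ^ 4 * (∑ i, √|η i|) ^ 4 := by ring
    _ ≤ 16 * n ^ 4 * (n ^ 3 * ∑ i, η i ^ 2) := by
      gcongr; exact sum_sqrt_abs_pow_four_le η
    _ = 16 * n ^ 7 * ∑ i, η i ^ 2 := by ring

theorem kendallDist_le_sq (σ : Equiv.Perm (Fin n)) : kendallDist σ ≤ n ^ 2 := by
  refine (Finset.card_filter_le _ _).trans ?_
  simp [sq]

end Inversions

/-! ### Second eigenvectors of the adjacency matrix -/

section Assembly

variable {n : ℕ} {p t : ℝ} {G : SimpleGraph (Fin n)}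

theorem dotProduct_self_nonneg_real (z : Fin n → ℝ) : 0 ≤ z ⬝ᵥ z :=
  Finset.sum_nonneg fun i _ => mul_self_nonneg (z i)

/-- The entries of `E ^ 2` control its Frobenius norm, and with it the operator norm of `E`. -/
theorem abs_dotProduct_noise_mulVec_le (hp0 : 0 ≤ p) (hp1 : p ≤ 1)
    (h2 : ∀ i j, i ≠ j → |∑ k, noise p G i k * noise p G j k| ≤ t)
    (htn : t ^ 2 + n ≤ 1e-10 * p ^ 4 * n ^ 2) (z : Fin n → ℝ) :
    |z ⬝ᵥ noise p G *ᵥ z| ≤ 0.005 * (p * n) * (z ⬝ᵥ z) := by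
  set E := noise p G with hE
  have hQ : ∀ i j, (E * E) i j = ∑ k, E i k * E j k := by
    intro i j
    rw [Matrix.mul_apply]
    exact Finset.sum_congr rfl fun k _ => by rw [hE, noise_comm G k j]
  have hQ2 : ∀ i j, (E * E) i j ^ 2 ≤ t ^ 2 + if i = j then (n : ℝ) ^ 2 else 0 := by
    intro i j
    rw [hQ]
    by_cases h : i = j
    · subst h
      have h0 : 0 ≤ ∑ k, E i k * E i k := Finset.sum_nonneg fun k _ => mul_self_nonneg _
      have h1 : ∑ k, E i k * E i k ≤ n := by
        calc ∑ k, E i k * E i k ≤ ∑ k : Fin n, (1 : ℝ) := by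
              refine Finset.sum_le_sum fun k _ => ?_
              rw [← abs_mul_abs_self]
              exact mul_le_one₀ (abs_noise_le hp0 hp1 G i k) (abs_nonneg _)
                (abs_noise_le hp0 hp1 G i k)
          _ = n := by simp
      rw [if_pos rfl]
      nlinarith [sq_nonneg t]
    · rw [if_neg h, add_zero]
      exact sq_le_sq' (by linarith [(abs_le.1 (h2 i j h)).1]) (abs_le.1 (h2 i j h)).2
  have hF : ∑ i, ∑ j, (E * E) i j ^ 2 ≤ n ^ 2 * (t ^ 2 + n) := by
    calc _ ≤ ∑ i : Fin n, ∑ j : Fin n, (t ^ 2 + if i = j then (n : ℝ) ^ 2 else 0) :=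
          Finset.sum_le_sum fun i _ => Finset.sum_le_sum fun j _ => hQ2 i j
      _ = n ^ 2 * (t ^ 2 + n) := by
          simp [Finset.sum_add_distrib]; ring
  have hzz := dotProduct_self_nonneg_real z
  have hsym : E.IsSymm := by
    ext i j; exact noise_comm G j i
  have hEz : (E *ᵥ z) ⬝ᵥ (E *ᵥ z) = z ⬝ᵥ (E * E) *ᵥ z := by
    rw [← Matrix.mulVec_mulVec, Matrix.dotProduct_mulVec z, ← Matrix.mulVec_transpose, hsym.eq]
  have h3 : (E *ᵥ z) ⬝ᵥ (E *ᵥ z) ≤ 1e-5 * p ^ 2 * n ^ 2 * (z ⬝ᵥ z) := by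
    rw [hEz]
    refine le_of_sq_le_sq ?_ (by positivity)
    calc _ ≤ _ := dotProduct_mulVec_sq_le (E * E) z
      _ ≤ (n ^ 2 * (1e-10 * p ^ 4 * n ^ 2)) * (z ⬝ᵥ z) ^ 2 := by
        gcongr
        exact hF.trans (by gcongr)
      _ = _ := by ring
  have h4 : (z ⬝ᵥ E *ᵥ z) ^ 2 ≤ (z ⬝ᵥ z) * ((E *ᵥ z) ⬝ᵥ (E *ᵥ z)) := by
    have := Finset.sum_mul_sq_le_sq_mul_sq Finset.univ z (E *ᵥ z)
    simpa only [dotProduct, sq] using this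
  refine abs_le_of_sq_le_sq ?_ (by positivity)
  calc _ ≤ _ := h4
    _ ≤ (z ⬝ᵥ z) * (1e-5 * p ^ 2 * n ^ 2 * (z ⬝ᵥ z)) := by gcongr
    _ ≤ _ := by
      have : 0 ≤ p ^ 2 * n ^ 2 * (z ⬝ᵥ z) ^ 2 := by positivity
      nlinarith

theorem abs_dotProduct_modelMatrix_mulVec_sub_le (hn : 6000 ≤ n) (hp : 0 ≤ p) (z : Fin n → ℝ) :
    |z ⬝ᵥ modelMatrix n p *ᵥ z - 3 / 4 * p * (∑ i, z i) ^ 2 -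
      2 * modelEigenvalue n p / n * (cosVec n ⬝ᵥ z) ^ 2| ≤ 0.295 * (p * n) * (z ⬝ᵥ z) := by
  set R : Matrix (Fin n) (Fin n) ℝ := Matrix.of fun i j => modelMatrix n p i j - 3 / 4 * p -
    2 * modelEigenvalue n p / n * (cosVec n i * cosVec n j) with hR
  have e : z ⬝ᵥ modelMatrix n p *ᵥ z - 3 / 4 * p * (∑ i, z i) ^ 2 -
      2 * modelEigenvalue n p / n * (cosVec n ⬝ᵥ z) ^ 2 = z ⬝ᵥ R *ᵥ z := by
    have e1 : (∑ i, z i) ^ 2 = ∑ i, ∑ j, z i * z j := by rw [sq, Finset.sum_mul_sum]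
    have e2 : (cosVec n ⬝ᵥ z) ^ 2 = ∑ i, ∑ j, cosVec n i * z i * (cosVec n j * z j) := by
      rw [sq, dotProduct, Finset.sum_mul_sum]
    rw [e1, e2]
    simp only [hR, dotProduct, mulVec, Matrix.of_apply, Finset.mul_sum, ← Finset.sum_sub_distrib]
    exact Finset.sum_congr rfl fun i _ => Finset.sum_congr rfl fun j _ => by ring
  rw [e]
  have hzz := dotProduct_self_nonneg_real z
  refine abs_le_of_sq_le_sq ?_ (by positivity)
  refine (dotProduct_mulVec_sq_le R z).trans ?_
  rw [mul_pow]
  exact mul_le_mul_of_nonneg_right (modelMatrix_frobenius_le hn hp) (sq_nonneg _)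

theorem inner_toEuclideanLin (A : Matrix (Fin n) (Fin n) ℝ) (z w : EuclideanSpace ℝ (Fin n)) :
    inner ℝ z (A.toEuclideanLin w) = z.ofLp ⬝ᵥ A *ᵥ w.ofLp := by
  rw [EuclideanSpace.inner_eq_star_dotProduct, dotProduct_comm, Matrix.toLpLin_apply]
  simp

/-- If the noise is small, the adjacency matrix is approximately decomposed by the normalized
constant vector and the normalized sampled cosine. The error `κ` of the eigenvector equation comes
from the noise applied to the cosine alone; the operator norm of the noise enters only in `ρ`. -/
theorem approxDecomp_adjacency (hp0 : 0 < p) (hp1 : p ≤ 1) (hn : 6000 ≤ n) (ht : 0 ≤ t)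
    (h1 : ∀ i, |∑ j, noise p G i j * cosVec n j| ≤ t)
    (h2 : ∀ i j, i ≠ j → |∑ k, noise p G i k * noise p G j k| ≤ t)
    (htn : t ^ 2 + n ≤ 1e-10 * p ^ 4 * n ^ 2) :
    ApproxDecomp (adjacency G).toEuclideanLin
      (WithLp.toLp 2 fun _ => 1 / √n) (WithLp.toLp 2 (√(2 / n) • cosVec n))
      (3 / 4 * (p * n)) (modelEigenvalue n p) (0.3 * (p * n)) (2 * (t + 2)) (0.01 * (p * n)) := by
  have hn' : (6000 : ℝ) ≤ n := by exact_mod_cast hn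
  have hpn : 0 < p * n := by positivity
  obtain ⟨hl1, hl2⟩ := modelEigenvalue_bounds (n := n) (by omega) hp0.le
  have hl3 : 0.318 * (p * n) ≤ modelEigenvalue n p := by
    refine le_trans ?_ hl1
    rw [le_div_iff₀ Real.pi_pos]
    nlinarith [Real.pi_lt_d4]
  have hA : adjacency G = modelMatrix n p + noise p G := by simp [noise]
  have hsn : √(n : ℝ) ^ 2 = n := Real.sq_sqrt (by positivity)
  have hs2 : √(2 / (n : ℝ)) ^ 2 = 2 / n := Real.sq_sqrt (by positivity)
  have hκ : 2 * (t + 2) ≤ 0.002 * (p * n) := by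
    refine le_of_sq_le_sq ?_ (by positivity)
    have hp4 : p ^ 4 ≤ p ^ 2 := pow_le_pow_of_le_one hp0.le hp1 (by norm_num)
    have : p ^ 4 * n ^ 2 ≤ p ^ 2 * n ^ 2 := by gcongr
    nlinarith [sq_nonneg (t - 2)]
  have hquad : ∀ z : Fin n → ℝ, |z ⬝ᵥ adjacency G *ᵥ z - 3 / 4 * p * (∑ i, z i) ^ 2 -
      2 * modelEigenvalue n p / n * (cosVec n ⬝ᵥ z) ^ 2| ≤ 0.3 * (p * n) * (z ⬝ᵥ z) := by
    intro z
    have e1 := abs_le.1 (abs_dotProduct_modelMatrix_mulVec_sub_le hn hp0.le z)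
    have e2 := abs_le.1 (abs_dotProduct_noise_mulVec_le hp0.le hp1 h2 htn z)
    rw [hA, Matrix.add_mulVec, dotProduct_add, abs_le]
    constructor <;> linarith [e1.1, e1.2, e2.1, e2.2]
  refine ⟨?_, ?_, ?_, ?_, ?_, ?_, by positivity, by linarith, by positivity, by linarith, ?_⟩
  · exact Matrix.isSymmetric_toEuclideanLin_iff.2 (adjacency_isHermitian G)
  · rw [← sq_eq_sq₀ (norm_nonneg _) zero_le_one, EuclideanSpace.real_norm_sq_eq]
    simp only [div_pow, hsn]
    simp
    field_simp
  · rw [← sq_eq_sq₀ (norm_nonneg _) zero_le_one, EuclideanSpace.real_norm_sq_eq]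
    simp only [Pi.smul_apply, smul_eq_mul, mul_pow, hs2]
    rw [← Finset.mul_sum, sum_sq_cosVec (by omega)]
    field_simp
  · rw [EuclideanSpace.inner_eq_star_dotProduct]
    simp only [dotProduct, Pi.smul_apply, smul_eq_mul, Pi.star_apply, star_trivial]
    rw [← Finset.sum_mul, ← Finset.mul_sum, sum_cosVec (by omega)]
    simp
  · intro z
    have h := hquad z.ofLp
    rw [inner_toEuclideanLin, EuclideanSpace.inner_eq_star_dotProduct,
      EuclideanSpace.inner_eq_star_dotProduct, EuclideanSpace.real_norm_sq_eq]
    have e1 : (z.ofLp ⬝ᵥ star fun _ => 1 / √(n : ℝ)) = 1 / √(n : ℝ) * ∑ i, z i := by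
      simp only [dotProduct, Pi.star_apply, star_trivial]
      rw [← Finset.sum_mul, mul_comm]
    have e2 : z.ofLp ⬝ᵥ star (√(2 / (n : ℝ)) • cosVec n) =
        √(2 / (n : ℝ)) * (cosVec n ⬝ᵥ z.ofLp) := by
      rw [star_trivial, dotProduct_smul, dotProduct_comm, smul_eq_mul]
    have e3 : z.ofLp ⬝ᵥ z.ofLp = ∑ i, z i ^ 2 := by simp only [dotProduct, sq]
    rw [e3] at h
    rw [e1, e2, mul_pow, mul_pow, hs2, div_pow, hsn]
    have e4 : 3 / 4 * (p * n) * (1 ^ 2 / n * (∑ i, z i) ^ 2) = 3 / 4 * p * (∑ i, z i) ^ 2 := by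
      field_simp
    have e5 : modelEigenvalue n p * (2 / n * (cosVec n ⬝ᵥ z.ofLp) ^ 2) =
        2 * modelEigenvalue n p / n * (cosVec n ⬝ᵥ z.ofLp) ^ 2 := by ring
    rw [e4, e5]
    exact h
  · refine le_of_sq_le_sq ?_ (by positivity)
    rw [EuclideanSpace.real_norm_sq_eq]
    have hcoord : ∀ i,
        |(adjacency G *ᵥ cosVec n) i - modelEigenvalue n p * cosVec n i| ≤ t + 2 := by
      intro i
      have e1 := abs_le.1 (abs_modelMatrix_mulVec_cosVec_sub_le hp0.le i)
      have e2 := abs_le.1 (h1 i)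
      rw [hA, Matrix.add_mulVec, Pi.add_apply, abs_le]
      have e3 : (noise p G *ᵥ cosVec n) i = ∑ j, noise p G i j * cosVec n j := rfl
      rw [e3]
      constructor <;> linarith [e1.1, e1.2, e2.1, e2.2]
    calc _ = ∑ i, 2 / (n : ℝ) *
          ((adjacency G *ᵥ cosVec n) i - modelEigenvalue n p * cosVec n i) ^ 2 := by
          refine Finset.sum_congr rfl fun i _ => ?_
          rw [Matrix.toLpLin_apply]
          simp only [Matrix.mulVec_smul, PiLp.sub_apply, PiLp.smul_apply, Pi.smul_apply,
            smul_eq_mul]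
          linear_combination ((adjacency G *ᵥ cosVec n) i -
            modelEigenvalue n p * cosVec n i) ^ 2 * hs2
      _ ≤ ∑ i : Fin n, 2 / (n : ℝ) * (t + 2) ^ 2 := by
          refine Finset.sum_le_sum fun i _ => ?_
          rw [← sq_abs (_ - _)]
          gcongr
          exact hcoord i
      _ = 2 * (t + 2) ^ 2 := by
          simp; field_simp
      _ ≤ (2 * (t + 2)) ^ 2 := by nlinarith [sq_nonneg (t + 2)]
  · rw [inner_toEuclideanLin]
    have e1 : (fun _ => 1 / √(n : ℝ) : Fin n → ℝ) = (1 / √(n : ℝ)) • 1 := by ext; simp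
    simp only [e1, Matrix.mulVec_smul, dotProduct_smul, smul_dotProduct, smul_eq_mul]
    have e2 := abs_le.1 (abs_dotProduct_noise_mulVec_le hp0.le hp1 h2 htn 1)
    have e3 := le_sum_modelMatrix (n := n) hp0.le
    have e4 : (1 : Fin n → ℝ) ⬝ᵥ modelMatrix n p *ᵥ 1 = ∑ i, ∑ j, modelMatrix n p i j := by
      simp [dotProduct, mulVec]
    have e5 : (1 : Fin n → ℝ) ⬝ᵥ 1 = n := by simp
    rw [e5] at e2
    have e8 : ∀ q : ℝ, 1 / √(n : ℝ) * (1 / √(n : ℝ) * q) = q / n := by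
      intro q
      rw [← mul_assoc, ← sq, div_pow, hsn]
      ring
    rw [hA, Matrix.add_mulVec, dotProduct_add, e4, e8, le_div_iff₀ (by positivity)]
    have e6 : (modelEigenvalue n p + 2 * (2 * (t + 2)) + 0.01 * (p * n)) * n ≤
        (0.514 * (p * n)) * n := by gcongr; linarith
    have e7 : 6000 * (p * n) ≤ (p * n) * n := by nlinarith
    nlinarith [e2.1]

/-- If the noise is small, every second eigenvector is a multiple of an `ℓ²`-perturbation of
the sampled cosine. -/
theorem exists_eq_mul_cosVec_add (hp0 : 0 < p) (hp1 : p ≤ 1) (hn : 6000 ≤ n) (ht : 0 ≤ t)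
    (h1 : ∀ i, |∑ j, noise p G i j * cosVec n j| ≤ t)
    (h2 : ∀ i j, i ≠ j → |∑ k, noise p G i k * noise p G j k| ≤ t)
    (htn : t ^ 2 + n ≤ 1e-10 * p ^ 4 * n ^ 2) {y : Fin n → ℝ}
    (hy : IsSecondEigenvector (adjacency_isHermitian G) y) :
    ∃ (c : ℝ) (η : Fin n → ℝ), c ≠ 0 ∧ (∀ i, y i = c * (cosVec n i + η i)) ∧
      ∑ i, η i ^ 2 ≤ 40000 * (t ^ 2 + n) / (p ^ 2 * n) := by
  have hn' : (6000 : ℝ) ≤ n := by exact_mod_cast hn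
  obtain ⟨hy0, μ, hμ, hAy⟩ := hy
  have hD := approxDecomp_adjacency hp0 hp1 hn ht h1 h2 htn
  set x : EuclideanSpace ℝ (Fin n) := WithLp.toLp 2 (√(2 / n) • cosVec n) with hx
  set Y : EuclideanSpace ℝ (Fin n) := WithLp.toLp 2 y with hY
  have hTY : (adjacency G).toEuclideanLin Y = μ • Y := by
    rw [Matrix.toLpLin_apply, hY, ← WithLp.toLp_smul, ← hAy]
  have hb : ∀ k, (adjacency G).toEuclideanLin ((adjacency_isHermitian G).eigenvectorBasis k) =
      (adjacency_isHermitian G).eigenvalues k • (adjacency_isHermitian G).eigenvectorBasis k := by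
    intro k
    rw [Matrix.toLpLin_apply, (adjacency_isHermitian G).mulVec_eigenvectorBasis]
    rfl
  have hmain := hD.norm_sub_le_of_isSecondBy _ hb hμ hTY
  set a := inner ℝ x Y with ha
  set w := Y - a • x with hw
  have hs : 0 < √(2 / (n : ℝ)) := Real.sqrt_pos.2 (by positivity)
  have hs2 : √(2 / (n : ℝ)) ^ 2 = 2 / n := Real.sq_sqrt (by positivity)
  have hg : 0 < 0.01 * (p * n) := by positivity
  have ha0 : a ≠ 0 := by
    intro h0
    rw [h0, abs_zero, mul_zero] at hmain
    have hw0 : ‖w‖ = 0 := le_antisymm (nonpos_of_mul_nonpos_right hmain hg) (norm_nonneg _)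
    rw [norm_eq_zero, hw, h0, zero_smul, sub_zero] at hw0
    exact hy0 (by simpa [hY] using hw0)
  refine ⟨a * √(2 / n), fun i => w i / (a * √(2 / n)), mul_ne_zero ha0 hs.ne', ?_, ?_⟩
  · intro i
    have e : y i = a * (√(2 / n) * cosVec n i) + w i := by
      simp [hw, hY, hx]
    rw [e]
    field_simp
  · simp only [div_pow]
    rw [← Finset.sum_div, ← EuclideanSpace.real_norm_sq_eq, mul_pow, hs2]
    have h3 : (0.01 * (p * n) * ‖w‖) ^ 2 ≤ (2 * (t + 2) * |a|) ^ 2 :=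
      pow_le_pow_left₀ (by positivity) hmain 2
    rw [mul_pow _ |a|, sq_abs] at h3
    have ha2 : 0 < a ^ 2 := by positivity
    rw [div_le_div_iff₀ (by positivity) (by positivity)]
    have h4 : (t + 2) ^ 2 ≤ 2 * (t ^ 2 + n) := by nlinarith [sq_nonneg (t - 2)]
    have h5 : (2 * (t + 2)) ^ 2 * a ^ 2 ≤ 8 * (t ^ 2 + n) * a ^ 2 := by
      refine mul_le_mul_of_nonneg_right ?_ ha2.le
      nlinarith
    have h6 : (p * n) ^ 2 * ‖w‖ ^ 2 ≤ 80000 * (t ^ 2 + n) * a ^ 2 := by nlinarith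
    have h7 : ‖w‖ ^ 2 * (p ^ 2 * n) = ((p * n) ^ 2 * ‖w‖ ^ 2) / n := by field_simp
    rw [h7, div_le_iff₀ (by positivity)]
    refine h6.trans (le_of_eq ?_)
    field_simp
    ring

/-- The quantity `12 n log n` is eventually small compared with any multiple of `n ^ 2`. -/
theorem exists_forall_log_le {ε : ℝ} (hε : 0 < ε) :
    ∃ N : ℕ, ∀ n : ℕ, N ≤ n → 12 * n * Real.log n + n ≤ ε * (n : ℝ) ^ 2 := by
  have h1 : ∀ᶠ x : ℝ in Filter.atTop, 12 * Real.log x + 1 ≤ ε * x := by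
    have h2 := Real.isLittleO_log_id_atTop.bound (show 0 < ε / 24 by positivity)
    filter_upwards [h2, Filter.eventually_ge_atTop (2 / ε), Filter.eventually_ge_atTop 0]
      with x hx hx2 hx0
    rw [Real.norm_eq_abs, id, Real.norm_of_nonneg hx0] at hx
    have h3 := le_abs_self (Real.log x)
    rw [div_le_iff₀ hε] at hx2
    linarith
  obtain ⟨N, hN⟩ := Filter.eventually_atTop.1 (tendsto_natCast_atTop_atTop.eventually h1)
  refine ⟨N, fun n hn => ?_⟩
  have := mul_le_mul_of_nonneg_left (hN n hn) (show (0 : ℝ) ≤ n by positivity)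
  linarith

theorem log_factor_le {n : ℕ} (hn : 1 ≤ n) :
    12 * Real.log n + 1 ≤ 61 * (n : ℝ) ^ (1 / 5 : ℝ) := by
  have hn' : (1 : ℝ) ≤ n := by exact_mod_cast hn
  have h1 := Real.log_le_rpow_div (x := n) (ε := 1 / 5) (by positivity) (by norm_num)
  have h2 : (1 : ℝ) ≤ (n : ℝ) ^ (1 / 5 : ℝ) := Real.one_le_rpow hn' (by norm_num)
  linarith

end Assembly

theorem mainTheorem2 (p : ℝ) (hp0 : 0 < p) (hp1 : p ≤ 1) :
    ∃ C : ℝ, 0 < C ∧ ∀ n : ℕ, 1 ≤ n →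
      ∀ (Ω : Type*) [MeasurableSpace Ω] (P : Measure Ω) [IsProbabilityMeasure P]
        (G : Ω → SimpleGraph (Fin n)), IsRandomLinearGraph p G P →
        1 - 1 / (n : ℝ) ^ 3 ≤ P.real {ω | ∀ y : Fin n → ℝ,
          IsSecondEigenvector (adjacency_isHermitian (G ω)) y →
            (∀ σ, IsSortingPerm y σ → (kendallDist σ : ℝ) ≤ C * (n : ℝ) ^ (9 / 5 : ℝ)) ∨
            (∀ σ, IsSortingPerm (-y) σ →
              (kendallDist σ : ℝ) ≤ C * (n : ℝ) ^ (9 / 5 : ℝ))} := by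
  obtain ⟨N, hN⟩ := exists_forall_log_le (ε := 1e-10 * p ^ 4) (by positivity)
  set N' := max N 6000 with hN'
  set C : ℝ := N' ^ 2 + 4e7 / p ^ 2 with hC
  have hC1 : 1 ≤ C := by
    have h1 : (6000 : ℝ) ≤ N' := by exact_mod_cast le_max_right N 6000
    have : 0 < 4e7 / p ^ 2 := by positivity
    rw [hC]; nlinarith
  refine ⟨C, by linarith, fun n hn Ω _ P _ G hG => ?_⟩
  have hn' : (1 : ℝ) ≤ n := by exact_mod_cast hn
  have hpow1 : (1 : ℝ) ≤ (n : ℝ) ^ (9 / 5 : ℝ) := Real.one_le_rpow hn' (by norm_num)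
  set S := {ω | ∀ y : Fin n → ℝ, IsSecondEigenvector (adjacency_isHermitian (G ω)) y →
    (∀ σ, IsSortingPerm y σ → (kendallDist σ : ℝ) ≤ C * (n : ℝ) ^ (9 / 5 : ℝ)) ∨
    (∀ σ, IsSortingPerm (-y) σ → (kendallDist σ : ℝ) ≤ C * (n : ℝ) ^ (9 / 5 : ℝ))} with hS
  rcases lt_or_ge n N' with hsmall | hlarge
  · -- For small `n` the constant exceeds the number of all pairs.
    have hbound : ∀ σ : Equiv.Perm (Fin n), (kendallDist σ : ℝ) ≤ C * (n : ℝ) ^ (9 / 5 : ℝ) := by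
      intro σ
      have h1 : (kendallDist σ : ℝ) ≤ (n : ℝ) ^ 2 := by exact_mod_cast kendallDist_le_sq σ
      have h2 : (n : ℝ) ^ 2 ≤ (N' : ℝ) ^ 2 := by gcongr
      have h3 : (N' : ℝ) ^ 2 ≤ C := by rw [hC]; linarith [show 0 < 4e7 / p ^ 2 by positivity]
      nlinarith
    have hSu : S = Set.univ := Set.eq_univ_of_forall fun ω y _ => Or.inl fun σ _ => hbound σ
    rw [hSu, probReal_univ]
    linarith [show 0 ≤ 1 / (n : ℝ) ^ 3 by positivity]
  · have hn6 : 6000 ≤ n := (le_max_right N 6000).trans hlarge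
    have hlog : 0 ≤ Real.log n := Real.log_nonneg hn'
    have hbad := hG.measureReal_noise_large_le hp0.le hp1 (by omega) (f := cosVec n)
      abs_cosVec_le
    set t := √(12 * n * Real.log n) with ht
    have ht2 : t ^ 2 = 12 * n * Real.log n := Real.sq_sqrt (by positivity)
    have htn : t ^ 2 + n ≤ 1e-10 * p ^ 4 * n ^ 2 := by
      rw [ht2]; exact hN n ((le_max_left N 6000).trans hlarge)
    have hfinal : ∀ (σ : Equiv.Perm (Fin n)) (q : ℝ), q ≤ 40000 * (t ^ 2 + n) / (p ^ 2 * n) →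
        (kendallDist σ : ℝ) ^ 4 ≤ 16 * n ^ 7 * q →
        (kendallDist σ : ℝ) ≤ C * (n : ℝ) ^ (9 / 5 : ℝ) := by
      intro σ q hq hk
      refine le_of_pow_le_pow_left₀ (n := 4) (by norm_num) (by positivity) ?_
      have e1 : 40000 * (t ^ 2 + n) / (p ^ 2 * n) = 40000 * (12 * Real.log n + 1) / p ^ 2 := by
        rw [ht2]; field_simp
      have e2 : ((n : ℝ) ^ (9 / 5 : ℝ)) ^ 4 = (n : ℝ) ^ 7 * (n : ℝ) ^ (1 / 5 : ℝ) := by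
        rw [← Real.rpow_natCast, ← Real.rpow_natCast, ← Real.rpow_mul (by positivity),
          ← Real.rpow_add (by positivity)]
        norm_num
      have hCge : 4e7 / p ^ 2 ≤ C := by rw [hC]; linarith [sq_nonneg (N' : ℝ)]
      calc (kendallDist σ : ℝ) ^ 4 ≤ 16 * n ^ 7 * q := hk
        _ ≤ 16 * n ^ 7 * (40000 * (61 * (n : ℝ) ^ (1 / 5 : ℝ)) / p ^ 2) := by
          gcongr
          rw [e1] at hq
          refine hq.trans ?_
          gcongr
          exact log_factor_le hn
        _ = 3.904e7 / p ^ 2 * (n ^ 7 * (n : ℝ) ^ (1 / 5 : ℝ)) := by ring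
        _ ≤ C ^ 4 * (n ^ 7 * (n : ℝ) ^ (1 / 5 : ℝ)) := by
          gcongr
          calc 3.904e7 / p ^ 2 ≤ 4e7 / p ^ 2 := by gcongr; norm_num
            _ ≤ C := hCge
            _ ≤ C ^ 4 := le_self_pow₀ hC1 (by norm_num)
        _ = _ := by rw [mul_pow, e2]
    set B := {ω | ¬ ((∀ i, |∑ j, noise p (G ω) i j * cosVec n j| ≤ t) ∧
      ∀ i j, i ≠ j → |∑ k, noise p (G ω) i k * noise p (G ω) j k| ≤ t)} with hB
    have hcover : (Set.univ : Set Ω) ⊆ S ∪ B := by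
      intro ω _
      by_cases hω : ω ∈ B
      · exact Or.inr hω
      · left
        obtain ⟨h1, h2⟩ := not_not.1 hω
        intro y hy
        obtain ⟨c, η, hc, hyη, hη⟩ := exists_eq_mul_cosVec_add hp0 hp1 hn6 (Real.sqrt_nonneg _)
          h1 h2 htn hy
        rcases lt_or_gt_of_ne hc with hc | hc
        · exact Or.inr fun σ hσ => hfinal σ _ hη
            (kendallDist_pow_four_le (neg_pos.2 hc) (fun i => by rw [Pi.neg_apply, hyη]; ring) hσ)
        · exact Or.inl fun σ hσ => hfinal σ _ hη (kendallDist_pow_four_le hc hyη hσ)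
    have h1 : P.real Set.univ ≤ P.real S + P.real B :=
      (measureReal_mono hcover).trans (measureReal_union_le _ _)
    rw [probReal_univ] at h1
    linarith
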